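/- Let $\alpha\in(0,\infty)$, $\alpha\neq 1$, and put $\rho=\frac1\alpha-1$, so that $\alpha=\frac1{1+\rho}$. Let $\mu$ be a $\sigma$-finite measure on a measurable space $(\mathbb X,\mathcal X)$, and let $L^\alpha(\mu)$ carry the metric $d(f,g)=\left(\int|f-g|^\alpha\,d\mu\right)^{\min\{1,1/\alpha\}}$. For probability measures $P,Q\ll\mu$ with densities $p=\frac{dP}{d\mu}$, $q=\frac{dQ}{d\mu}$ in $L^\alpha(\mu)$, let $P',Q'$ be the tilted probability measures with $\mu$-densities $$p'=\frac{p^\alpha}{\int p^\alpha\,d\mu},\qquad q'=\frac{q^\alpha}{\int q^\alpha\,d\mu},$$ let $f(x)=\operatorname{sgn}(\rho)\,x^{1+\rho}$ for $x\ge 0$, and let $$I_f(P',Q')=\int q'\,f\!\left(\frac{p'}{q'}\right)d\mu,\qquad I_\alpha(P,Q)=\frac1\rho\log\left[\operatorname{sgn}(\rho)\,I_f(P',Q')\right]\in[0,\infty],$$ with the usual conventions $0\cdot f(\frac{a}{0})=a\lim_{t\to\infty}\frac{f(t)}{t}$ for $a>0$, $0\cdot f(\frac00)=0$, $\log 0=-\infty$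 and $\log\infty=\infty$. **Theorem.** Let $E$ be a set of probability measures on $(\mathbb X,\mathcal X)$ that are absolutely continuous with respect to $\mu$, such that the set of densities $\mathcal E=\left\{\frac{dP}{d\mu}:P\in E\right\}$ is contained in $L^\alpha(\mu)$, is convex, and is closed in $L^\alpha(\mu)$. Let $R\ll\mu$ be a probability measure with $\frac{dR}{d\mu}\in L^\alpha(\mu)$, and suppose that $I_\alpha(P,R)<\infty$ for some $P\in E$. Then $R$ has an $I_\alpha$-projection on $E$, that is, there is $Q\in E$ with $$I_\alpha(Q,R)=\inf_{P\in E}I_\alpha(P,R).$$ -/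

import Mathlib

open MeasureTheory
open scoped ENNReal

namespace AlphaEntropy

noncomputable section

/-- The parameter `ρ` with `α = 1 / (1 + ρ)`. -/
def rho (α : ℝ) : ℝ := 1 / α - 1

/-- The quantity `q * (p / q) ^ (1 + ρ)`, i.e. `sgn(ρ) * q * f (p / q)` for
`f x = sgn(ρ) * x ^ (1 + ρ)`. At `q = 0` the usual convention for `f`-divergences
`0 * f (p / 0) = p * lim_{t → ∞} f t / t` is used: `f t / t = sgn(ρ) * t ^ ρ` tends to `∞` if
`ρ > 0` and to `0` if `-1 < ρ < 0` (and `0 * ∞ = 0` when `p = 0`). -/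
def powPerspective (ρ : ℝ) (p q : ℝ≥0∞) : ℝ≥0∞ :=
  if q = 0 then (if 0 < ρ then p * ∞ else 0) else q * (p / q) ^ (1 + ρ)

variable {X : Type*} [MeasurableSpace X]

/-- Csiszár's `f`-divergence `I_f(P, Q) = ∫ q f (p / q) dμ` for `f x = sgn(ρ) * x ^ (1 + ρ)`, with
`p = dP/dμ` and `q = dQ/dμ`. As `f` has constant sign, the sign is taken out of the integral. -/
def fDivergence (ρ : ℝ) (μ P Q : Measure X) : EReal :=
  ((Real.sign ρ : ℝ) : EReal) *
    ((∫⁻ x, powPerspective ρ (P.rnDeriv μ x) (Q.rnDeriv μ x) ∂μ : ℝ≥0∞) : EReal)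

/-- The tilted measure `P'`, with `dP'/dμ = p ^ α / ∫ p ^ α dμ` where `p = dP/dμ`. -/
def tilted (α : ℝ) (μ P : Measure X) : Measure X :=
  μ.withDensity fun x => (P.rnDeriv μ x) ^ α / ∫⁻ y, (P.rnDeriv μ y) ^ α ∂μ

/-- The `α`-relative entropy `I_α(P, Q) = (1 / ρ) log (sgn(ρ) * I_f(P', Q'))` with respect to the
dominating measure `μ`, with values in `[-∞, ∞]`, where `log 0 = -∞` and `log ∞ = ∞`. -/
def alphaRelEntropy (α : ℝ) (μ P Q : Measure X) : EReal :=
  ((1 / rho α : ℝ) : EReal) *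
    ENNReal.log (((Real.sign (rho α) : ℝ) : EReal) *
      fDivergence (rho α) μ (tilted α μ P) (tilted α μ Q)).toENNReal

/-- The real-valued density `dP/dμ`. -/
def density (μ P : Measure X) (x : X) : ℝ := (P.rnDeriv μ x).toReal

/-- The set of `μ`-densities of the members of `E`, as a subset of `L^α(μ)`. -/
def densitySet (α : ℝ) (μ : Measure X) (E : Set (ProbabilityMeasure X)) :
    Set (Lp ℝ (ENNReal.ofReal α) μ) :=
  {p | ∃ P ∈ E, p =ᵐ[μ] density μ (P : Measure X)}

/-- The metric `d(f, g) = (∫ |f - g| ^ α dμ) ^ min {1, 1 / α}` of `L^α(μ)`. -/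
def lpDist (α : ℝ) {μ : Measure X} (f g : Lp ℝ (ENNReal.ofReal α) μ) : ℝ≥0∞ :=
  (∫⁻ x, ‖f x - g x‖ₑ ^ α ∂μ) ^ min 1 (1 / α)

/-- A subset of the metric space `(L^α(μ), d)` is closed: it contains each point of `L^α(μ)` that
has points of the set at arbitrarily small distance. (For `α < 1` Mathlib puts no topology on
`L^α(μ)`.) -/
def IsLpClosed (α : ℝ) {μ : Measure X} (S : Set (Lp ℝ (ENNReal.ofReal α) μ)) : Prop :=
  ∀ f : Lp ℝ (ENNReal.ofReal α) μ, (∀ ε : ℝ≥0∞, 0 < ε → ∃ g ∈ S, lpDist α f g < ε) → f ∈ S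

/-- `Q` is an `I_α`-projection of `R` on `E`: it lies in `E` and attains
`inf_{P ∈ E} I_α(P, R)`. -/
def IsAlphaProjection (α : ℝ) (μ : Measure X) (E : Set (ProbabilityMeasure X))
    (R Q : ProbabilityMeasure X) : Prop :=
  Q ∈ E ∧ alphaRelEntropy α μ (Q : Measure X) (R : Measure X) =
    ⨅ P ∈ E, alphaRelEntropy α μ (P : Measure X) (R : Measure X)

end

end AlphaEntropy

open Filter Topology

/-! Write `p`, `r` for the densities of `P`, `R`. Since `1 + ρ = 1/α`, tilting cancels the power in
`f`, and `I_α(P, R)` becomes `(1/ρ) log (κ · F(p) / ‖p‖_α)` with `F(p) = ∫ p r^(α-1) dμ` linear in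
`p` and `κ` a positive constant depending on `R` only (`alphaRelEntropy_eq`). So the task is to
minimize `F / ‖·‖_α` over a closed convex set when `α < 1` (`ρ > 0`), and to maximize it when `α >
1` (`ρ < 0`). The optimum `c` is positive and finite by the reverse Hölder inequality, respectively
Hölder's inequality, and the finiteness hypothesis.

Take an optimizing sequence `p_n` and normalize: `u_n = p_n / ‖p_n‖_α`. The midpoint of `u_n` and
`u_m` is a multiple of a convex combination of `p_n` and `p_m`, hence of a member of the convex set.
Optimality of `c` bounds its norm on one side by a quantity tending to 1; convexity or concavity of
`t ↦ t^α` bounds it by 1 on the other side. The integrated midpoint defect of `t^α` therefore tends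
to zero. Strict convexity or concavity with homogeneity makes `u_n^α` Cauchy in `L^1`, so `u_n`
tends to a unit vector `v` in `L^α` (`exists_tendsto_of_midpointGap`, `exists_tendsto_normalized`).

The norms `‖p_n‖_α` cannot accumulate at 0, since 0 would then lie in the closed set, nor at ∞,
since `∫ p_n = 1` would force `v = 0`. A subsequence of `p_n` thus converges to `T v` with `T > 0`,
which is the density of some `Q` in `E` (`exists_mem_normalized_limit`). By homogeneity its ratio is
`F(v)`, and semicontinuity of `F` in the required direction (Fatou for `α < 1`, boundedness on `L^α`
for `α > 1`) shows that `Q` is optimal. -/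

namespace AlphaEntropy

/-! ### Homogeneous inequalities on the quadrant and the midpoint defect -/

/-- Two continuous functions on the quadrant, homogeneous of the same degree `α`, are comparable up
to a small multiple of `x ^ α + y ^ α` as soon as the first vanishes where the second does. -/
theorem exists_le_add_mul_of_homogeneous {α : ℝ} (hα : 0 < α) {H K : ℝ → ℝ → ℝ}
    (hHc : Continuous fun z : ℝ × ℝ => H z.1 z.2) (hKc : Continuous fun z : ℝ × ℝ => K z.1 z.2)
    (hH : ∀ t x y, 0 ≤ t → 0 ≤ x → 0 ≤ y → H (t * x) (t * y) = t ^ α * H x y)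
    (hK : ∀ t x y, 0 ≤ t → 0 ≤ x → 0 ≤ y → K (t * x) (t * y) = t ^ α * K x y)
    (hK0 : ∀ x y, 0 ≤ x → 0 ≤ y → 0 ≤ K x y)
    (hKH : ∀ x y, 0 ≤ x → 0 ≤ y → K x y = 0 → H x y = 0) {ε : ℝ} (hε : 0 < ε) :
    ∃ C : ℝ, 0 ≤ C ∧ ∀ x y, 0 ≤ x → 0 ≤ y → H x y ≤ ε * (x ^ α + y ^ α) + C * K x y := by
  set L : ℝ × ℝ → ℝ := fun z => H z.1 z.2 - ε * (z.1 ^ α + z.2 ^ α) with hL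
  have hLc : Continuous L := by
    have h1 : Continuous fun z : ℝ × ℝ => z.1 ^ α := continuous_fst.rpow_const fun _ => .inr hα.le
    have h2 : Continuous fun z : ℝ × ℝ => z.2 ^ α := continuous_snd.rpow_const fun _ => .inr hα.le
    exact hHc.sub (continuous_const.mul (h1.add h2))
  -- By homogeneity the segment `x + y = 1` suffices. Only points with `L ≥ 0` matter; there `H >
  -- 0`, hence `K > 0`, and compactness bounds `L / K`.
  set A : Set (ℝ × ℝ) := (Set.Icc 0 1 ×ˢ Set.Icc 0 1) ∩ ({z | z.1 + z.2 = 1} ∩ {z | 0 ≤ L z})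
  have hA : IsCompact A := (isCompact_Icc.prod isCompact_Icc).inter_right
    ((isClosed_eq (continuous_fst.add continuous_snd) continuous_const).inter
      (isClosed_le continuous_const hLc))
  have hKpos : ∀ z ∈ A, 0 < K z.1 z.2 := by
    rintro ⟨x, y⟩ ⟨⟨⟨hx, -⟩, ⟨hy, -⟩⟩, hxy, hz⟩
    refine lt_of_le_of_ne (hK0 x y hx hy) fun h => ?_
    have h0 := hKH x y hx hy h.symm
    simp only [Set.mem_ofPred_eq, hL, h0] at hz hxy hx hy
    have hpos : 0 < x ^ α + y ^ α := by
      rcases hx.lt_or_eq with hx' | hx'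
      · have := Real.rpow_pos_of_pos hx' α
        have := Real.rpow_nonneg hy α
        linarith
      · have := Real.rpow_pos_of_pos (show 0 < y by linarith) α
        have := Real.rpow_nonneg hx α
        linarith
    nlinarith [mul_pos hε hpos]
  obtain ⟨C, hC⟩ := hA.bddAbove_image (f := fun z => L z / K z.1 z.2)
    (hLc.continuousOn.div hKc.continuousOn fun z hz => (hKpos z hz).ne')
  have key : ∀ x y, 0 ≤ x → 0 ≤ y → x + y = 1 → L (x, y) ≤ max C 0 * K x y := by
    intro x y hx hy hxy
    by_cases h0 : 0 ≤ L (x, y)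
    · have hz : (x, y) ∈ A := ⟨⟨⟨hx, by simp only; linarith⟩, ⟨hy, by simp only; linarith⟩⟩, hxy, h0⟩
      have := hC ⟨_, hz, rfl⟩
      rw [div_le_iff₀ (hKpos _ hz)] at this
      exact this.trans (mul_le_mul_of_nonneg_right (le_max_left _ _) (hKpos _ hz).le)
    · exact (not_le.1 h0).le.trans (mul_nonneg (le_max_right _ _) (hK0 x y hx hy))
  refine ⟨max C 0, le_max_right _ _, fun x y hx hy => ?_⟩
  rcases (add_nonneg hx hy).lt_or_eq with h | h
  · set t := x + y
    have hx' : 0 ≤ x / t := by positivity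
    have hy' : 0 ≤ y / t := by positivity
    have := key (x / t) (y / t) hx' hy' (by rw [← add_div]; exact div_self h.ne')
    have ex : x = t * (x / t) := by field_simp
    have ey : y = t * (y / t) := by field_simp
    rw [ex, ey, hH _ _ _ h.le hx' hy', hK _ _ _ h.le hx' hy', Real.mul_rpow h.le hx',
      Real.mul_rpow h.le hy']
    have ht : 0 < t ^ α := Real.rpow_pos_of_pos h α
    have := mul_le_mul_of_nonneg_left this ht.le
    simp only [hL] at this
    linarith
  · obtain rfl : x = 0 := by linarith
    obtain rfl : y = 0 := by linarith
    have h1 := hH 0 0 0 le_rfl le_rfl le_rfl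
    have h2 := hK 0 0 0 le_rfl le_rfl le_rfl
    simp only [mul_zero, Real.zero_rpow hα.ne', zero_mul] at h1 h2 ⊢
    simp [h1, h2]

/-- The defect of midpoint affinity of `t ↦ t ^ α`. -/
noncomputable def midpointGap (α x y : ℝ) : ℝ := |(x ^ α + y ^ α) / 2 - ((x + y) / 2) ^ α|

theorem midpointGap_nonneg (α x y : ℝ) : 0 ≤ midpointGap α x y := abs_nonneg _

theorem continuous_midpointGap {α : ℝ} (hα : 0 < α) :
    Continuous fun z : ℝ × ℝ => midpointGap α z.1 z.2 := by
  have h : Continuous fun x : ℝ => x ^ α := Real.continuous_rpow_const hα.le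
  unfold midpointGap
  exact ((((h.comp continuous_fst).add (h.comp continuous_snd)).div_const 2).sub
    (h.comp ((continuous_fst.add continuous_snd).div_const 2))).abs

theorem midpointGap_mul (α : ℝ) {t x y : ℝ} (ht : 0 ≤ t) (hx : 0 ≤ x) (hy : 0 ≤ y) :
    midpointGap α (t * x) (t * y) = t ^ α * midpointGap α x y := by
  unfold midpointGap
  rw [← mul_add, mul_div_assoc, Real.mul_rpow ht hx, Real.mul_rpow ht hy,
    Real.mul_rpow ht (by positivity), ← abs_of_nonneg (Real.rpow_nonneg ht α), ← abs_mul,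
    abs_of_nonneg (Real.rpow_nonneg ht α)]
  ring_nf

/-- For `1 < α` the power is midpoint convex. -/
theorem midpointGap_of_one_lt {α : ℝ} (hα : 1 < α) {x y : ℝ} (hx : 0 ≤ x) (hy : 0 ≤ y) :
    midpointGap α x y = (x ^ α + y ^ α) / 2 - ((x + y) / 2) ^ α := by
  refine abs_of_nonneg ?_
  have := (convexOn_rpow hα.le).2 hx hy (by norm_num : (0:ℝ) ≤ 1/2) (by norm_num : (0:ℝ) ≤ 1/2)
    (by norm_num)
  simp only [smul_eq_mul] at this
  rw [show (x + y) / 2 = 1 / 2 * x + 1 / 2 * y by ring]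
  linarith

/-- For `α < 1` the power is midpoint concave. -/
theorem midpointGap_of_lt_one {α : ℝ} (h0 : 0 < α) (hα : α < 1) {x y : ℝ} (hx : 0 ≤ x)
    (hy : 0 ≤ y) :
    midpointGap α x y = ((x + y) / 2) ^ α - (x ^ α + y ^ α) / 2 := by
  unfold midpointGap
  rw [abs_sub_comm]
  refine abs_of_nonneg ?_
  have := (Real.concaveOn_rpow h0.le hα.le).2 hx hy (by norm_num : (0:ℝ) ≤ 1/2)
    (by norm_num : (0:ℝ) ≤ 1/2) (by norm_num)
  simp only [smul_eq_mul] at this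
  rw [show (x + y) / 2 = 1 / 2 * x + 1 / 2 * y by ring]
  linarith

theorem eq_of_midpointGap_eq_zero {α : ℝ} (h0 : 0 < α) (h1 : α ≠ 1) {x y : ℝ} (hx : 0 ≤ x)
    (hy : 0 ≤ y) (h : midpointGap α x y = 0) : x = y := by
  by_contra hne
  rw [midpointGap, abs_eq_zero, show (x + y) / 2 = 1 / 2 * x + 1 / 2 * y by ring] at h
  rcases lt_or_gt_of_ne h1 with hα | hα
  · have := (Real.strictConcaveOn_rpow h0 hα).2 hx hy hne (by norm_num : (0:ℝ) < 1/2)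
      (by norm_num : (0:ℝ) < 1/2) (by norm_num)
    simp only [smul_eq_mul] at this
    linarith
  · have := (strictConvexOn_rpow hα).2 hx hy hne (by norm_num : (0:ℝ) < 1/2)
      (by norm_num : (0:ℝ) < 1/2) (by norm_num)
    simp only [smul_eq_mul] at this
    linarith

/-- By strict convexity or concavity the defect vanishes only on the diagonal, so the homogeneous
comparison applies. It turns a small integrated defect into `L^1`-closeness of `α`-th powers. -/
theorem exists_abs_rpow_sub_rpow_le {α : ℝ} (h0 : 0 < α) (h1 : α ≠ 1) {ε : ℝ} (hε : 0 < ε) :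
    ∃ C : ℝ, 0 ≤ C ∧ ∀ x y, 0 ≤ x → 0 ≤ y →
      |x ^ α - y ^ α| ≤ ε * (x ^ α + y ^ α) + C * midpointGap α x y := by
  have h : Continuous fun x : ℝ => x ^ α := Real.continuous_rpow_const h0.le
  refine exists_le_add_mul_of_homogeneous h0 (H := fun x y => |x ^ α - y ^ α|)
    (((h.comp continuous_fst).sub (h.comp continuous_snd)).abs)
    (continuous_midpointGap h0) ?_ (fun t x y => midpointGap_mul α)
    (fun x y _ _ => midpointGap_nonneg α x y) ?_ hε
  · intro t x y ht hx hy
    rw [Real.mul_rpow ht hx, Real.mul_rpow ht hy, ← mul_sub, abs_mul,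
      abs_of_nonneg (Real.rpow_nonneg ht α)]
  · intro x y hx hy h
    simp [eq_of_midpointGap_eq_zero h0 h1 hx hy h]

/-- Injectivity of `t ↦ t^α` on the half-line lets the comparison apply again; this passes from
`L^1` convergence of `α`-th powers back to `L^α` convergence. -/
theorem exists_abs_sub_rpow_le {α : ℝ} (h0 : 0 < α) {ε : ℝ} (hε : 0 < ε) :
    ∃ C : ℝ, 0 ≤ C ∧ ∀ x y, 0 ≤ x → 0 ≤ y →
      |x - y| ^ α ≤ ε * (x ^ α + y ^ α) + C * |x ^ α - y ^ α| := by
  have h : Continuous fun x : ℝ => x ^ α := Real.continuous_rpow_const h0.le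
  refine exists_le_add_mul_of_homogeneous h0 (H := fun x y => |x - y| ^ α)
    (K := fun x y => |x ^ α - y ^ α|)
    (h.comp (continuous_fst.sub continuous_snd).abs)
    (((h.comp continuous_fst).sub (h.comp continuous_snd)).abs) ?_ ?_
    (fun x y _ _ => abs_nonneg _) ?_ hε
  · intro t x y ht hx hy
    rw [← mul_sub, abs_mul, abs_of_nonneg ht, Real.mul_rpow ht (abs_nonneg _)]
  · intro t x y ht hx hy
    rw [Real.mul_rpow ht hx, Real.mul_rpow ht hy, ← mul_sub, abs_mul,
      abs_of_nonneg (Real.rpow_nonneg ht α)]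
  · intro x y hx hy h
    have : x = y := (Real.rpow_left_inj hx hy h0.ne').1 (sub_eq_zero.1 (abs_eq_zero.1 h))
    simp [this, h0.ne']

/-! ### Integrals of `α`-th powers and the `L^α` (quasi-)norm -/

variable {X : Type*} [MeasurableSpace X] {μ : Measure X}

theorem integral_const_mul_add_add {f g h : X → ℝ} (hf : Integrable f μ) (hg : Integrable g μ)
    (hh : Integrable h μ) (c d : ℝ) :
    ∫ x, (c * (f x + g x) + d * h x) ∂μ = c * (∫ x, f x ∂μ + ∫ x, g x ∂μ) + d * ∫ x, h x ∂μ := by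
  have h1 : Integrable (fun x => c * (f x + g x)) μ := (hf.add hg).const_mul c
  rw [integral_add h1 (hh.const_mul d), integral_const_mul, integral_const_mul, integral_add hf hg]

theorem integrable_rpow_of_memLp {α : ℝ} (h0 : 0 < α) {f : X → ℝ} (hf0 : 0 ≤ f)
    (hf : MemLp f (ENNReal.ofReal α) μ) : Integrable (fun x => f x ^ α) μ := by
  have := (integrable_norm_rpow_iff hf.1 (by simpa using h0) ENNReal.ofReal_ne_top).2 hf
  rw [ENNReal.toReal_ofReal h0.le] at this
  exact this.congr (.of_forall fun x => by simp only [Real.norm_of_nonneg (hf0 x)])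

theorem memLp_of_integrable_rpow {α : ℝ} (h0 : 0 < α) {f : X → ℝ} (hf0 : 0 ≤ f)
    (hfm : Measurable f) (hf : Integrable (fun x => f x ^ α) μ) :
    MemLp f (ENNReal.ofReal α) μ := by
  refine (integrable_norm_rpow_iff hfm.aestronglyMeasurable (by simpa using h0)
    ENNReal.ofReal_ne_top).1 ?_
  rw [ENNReal.toReal_ofReal h0.le]
  exact hf.congr (.of_forall fun x => by simp only [Real.norm_of_nonneg (hf0 x)])

theorem eLpNorm_eq_lintegral_rpow {α : ℝ} (h0 : 0 < α) (f : X → ℝ) :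
    eLpNorm f (ENNReal.ofReal α) μ = (∫⁻ x, ‖f x‖ₑ ^ α ∂μ) ^ (1 / α) := by
  rw [eLpNorm_eq_lintegral_rpow_enorm_toReal (by simpa using h0) ENNReal.ofReal_ne_top,
    ENNReal.toReal_ofReal h0.le]

theorem lintegral_enorm_rpow_eq {α : ℝ} (h0 : 0 < α) {f : X → ℝ}
    (hf : Integrable (fun x => |f x| ^ α) μ) :
    ∫⁻ x, ‖f x‖ₑ ^ α ∂μ = ENNReal.ofReal (∫ x, |f x| ^ α ∂μ) := by
  rw [ofReal_integral_eq_lintegral_ofReal hf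
    (.of_forall fun x => Real.rpow_nonneg (abs_nonneg _) _)]
  refine lintegral_congr fun x => ?_
  rw [← ENNReal.ofReal_rpow_of_nonneg (abs_nonneg _) h0.le, ← Real.enorm_eq_ofReal_abs]

theorem eLpNorm_eq_ofReal_integral {α : ℝ} (h0 : 0 < α) {f : X → ℝ} (hf0 : 0 ≤ f)
    (hf : Integrable (fun x => f x ^ α) μ) :
    eLpNorm f (ENNReal.ofReal α) μ = ENNReal.ofReal (∫ x, f x ^ α ∂μ) ^ (1 / α) := by
  have h : (fun x => |f x| ^ α) = fun x => f x ^ α := by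
    ext x; rw [abs_of_nonneg (hf0 x)]
  rw [eLpNorm_eq_lintegral_rpow h0, lintegral_enorm_rpow_eq h0 (by rwa [h]), h]

theorem tendsto_eLpNorm_zero_iff {α : ℝ} (h0 : 0 < α) {ι : Type*} {l : Filter ι} (f : ι → X → ℝ) :
    Tendsto (fun i => eLpNorm (f i) (ENNReal.ofReal α) μ) l (𝓝 0) ↔
      Tendsto (fun i => ∫⁻ x, ‖f i x‖ₑ ^ α ∂μ) l (𝓝 0) := by
  simp only [eLpNorm_eq_lintegral_rpow h0]
  constructor
  · intro h
    have := (ENNReal.continuous_rpow_const (y := α)).tendsto 0 |>.comp h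
    simpa [Function.comp_def, ← ENNReal.rpow_mul, h0.ne', h0] using this
  · intro h
    have := (ENNReal.continuous_rpow_const (y := 1 / α)).tendsto 0 |>.comp h
    rw [ENNReal.zero_rpow_of_pos (by positivity)] at this
    exact this

theorem add_div_two_rpow_le {α : ℝ} (h0 : 0 < α) {x y : ℝ} (hx : 0 ≤ x) (hy : 0 ≤ y) :
    ((x + y) / 2) ^ α ≤ x ^ α + y ^ α := by
  have h1 := Real.rpow_nonneg hx α
  have h2 := Real.rpow_nonneg hy α
  rcases le_total x y with h | h
  · have := Real.rpow_le_rpow (by positivity) (show (x + y) / 2 ≤ y by linarith) h0.le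
    linarith
  · have := Real.rpow_le_rpow (by positivity) (show (x + y) / 2 ≤ x by linarith) h0.le
    linarith

theorem integrable_midpoint_rpow {α : ℝ} (h0 : 0 < α) {f g : X → ℝ} (hfm : Measurable f)
    (hgm : Measurable g) (hf0 : 0 ≤ f) (hg0 : 0 ≤ g) (hf : Integrable (fun x => f x ^ α) μ)
    (hg : Integrable (fun x => g x ^ α) μ) :
    Integrable (fun x => ((f x + g x) / 2) ^ α) μ := by
  refine (hf.add hg).mono' (((hfm.add hgm).div_const 2).pow_const α).aestronglyMeasurable
    (.of_forall fun x => ?_)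
  have h1 := hf0 x
  have h2 := hg0 x
  simp only [Pi.zero_apply] at h1 h2
  rw [Real.norm_of_nonneg (by positivity)]
  exact add_div_two_rpow_le h0 h1 h2

theorem integrable_midpointGap {α : ℝ} (h0 : 0 < α) {f g : X → ℝ} (hfm : Measurable f)
    (hgm : Measurable g) (hf0 : 0 ≤ f) (hg0 : 0 ≤ g) (hf : Integrable (fun x => f x ^ α) μ)
    (hg : Integrable (fun x => g x ^ α) μ) :
    Integrable (fun x => midpointGap α (f x) (g x)) μ :=
  (((hf.add hg).div_const 2).sub (integrable_midpoint_rpow h0 hfm hgm hf0 hg0 hf hg)).abs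

/-- The defect has constant sign, so the absolute value leaves the integral. For unit vectors the
result depends only on the norm of the midpoint. -/
theorem integral_midpointGap {α : ℝ} (h0 : 0 < α) (h1 : α ≠ 1) {f g : X → ℝ} (hfm : Measurable f)
    (hgm : Measurable g) (hf0 : 0 ≤ f) (hg0 : 0 ≤ g) (hf : Integrable (fun x => f x ^ α) μ)
    (hg : Integrable (fun x => g x ^ α) μ) :
    ∫ x, midpointGap α (f x) (g x) ∂μ = SignType.sign (α - 1) *
      ((∫ x, f x ^ α ∂μ + ∫ x, g x ^ α ∂μ) / 2 - ∫ x, ((f x + g x) / 2) ^ α ∂μ) := by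
  have hI := integrable_midpoint_rpow h0 hfm hgm hf0 hg0 hf hg
  have e : ∫ x, ((f x ^ α + g x ^ α) / 2 - ((f x + g x) / 2) ^ α) ∂μ =
      (∫ x, f x ^ α ∂μ + ∫ x, g x ^ α ∂μ) / 2 - ∫ x, ((f x + g x) / 2) ^ α ∂μ := by
    have hfg : Integrable (fun x => (f x ^ α + g x ^ α) / 2) μ := (hf.add hg).div_const 2
    rw [integral_sub hfg hI, integral_div, integral_add hf hg]
  rw [← e, ← integral_const_mul]
  refine integral_congr_ae (.of_forall fun x => ?_)
  rcases lt_or_gt_of_ne h1 with h | h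
  · simp only [midpointGap_of_lt_one h0 h (hf0 x) (hg0 x), sign_neg (show α - 1 < 0 by linarith)]
    simp
  · simp only [midpointGap_of_one_lt h (hf0 x) (hg0 x), sign_pos (show 0 < α - 1 by linarith)]
    simp

theorem integrable_abs_sub_rpow {α : ℝ} (h0 : 0 < α) {f g : X → ℝ} (hfm : Measurable f)
    (hgm : Measurable g) (hf0 : 0 ≤ f) (hg0 : 0 ≤ g) (hf : Integrable (fun x => f x ^ α) μ)
    (hg : Integrable (fun x => g x ^ α) μ) :
    Integrable (fun x => |f x - g x| ^ α) μ := by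
  have := (integrable_norm_rpow_iff (hfm.sub hgm).aestronglyMeasurable (by simpa using h0)
    ENNReal.ofReal_ne_top).2 ((memLp_of_integrable_rpow h0 hf0 hfm hf).sub
      (memLp_of_integrable_rpow h0 hg0 hgm hg))
  rw [ENNReal.toReal_ofReal h0.le] at this
  exact this

/-! ### Convergence of optimizing sequences -/

/-- Nonnegative unit vectors of `L^α` whose midpoints have asymptotically unit norm converge. This
takes the place of uniform convexity, and is also valid for `α < 1`. -/
theorem exists_tendsto_of_midpointGap {α : ℝ} (h0 : 0 < α) (h1 : α ≠ 1) {u : ℕ → X → ℝ}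
    (hum : ∀ n, Measurable (u n)) (hu0 : ∀ n, 0 ≤ u n)
    (hui : ∀ n, Integrable (fun x => u n x ^ α) μ) (hu1 : ∀ n, ∫ x, u n x ^ α ∂μ = 1)
    (hgap : Tendsto (fun z : ℕ × ℕ => ∫ x, midpointGap α (u z.1 x) (u z.2 x) ∂μ) atTop (𝓝 0)) :
    ∃ v : X → ℝ, Measurable v ∧ 0 ≤ v ∧ Integrable (fun x => v x ^ α) μ ∧ ∫ x, v x ^ α ∂μ = 1 ∧
      Tendsto (fun n => eLpNorm (u n - v) (ENNReal.ofReal α) μ) atTop (𝓝 0) := by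
  have hcauchy : CauchySeq fun n => (hui n).toL1 := by
    rw [Metric.cauchySeq_iff]
    intro ε hε
    -- As both powers integrate to 1, `ε / 4` contributes `ε / 2`; the defect term supplies the
    -- other half.
    obtain ⟨C, hC, hle⟩ := exists_abs_rpow_sub_rpow_le h0 h1 (show 0 < ε / 4 by positivity)
    have hev : ∀ᶠ z : ℕ × ℕ in atTop, C * ∫ x, midpointGap α (u z.1 x) (u z.2 x) ∂μ < ε / 2 := by
      have := hgap.const_mul C
      rw [mul_zero] at this
      exact this.eventually_lt_const (by positivity)
    rw [← prod_atTop_atTop_eq] at hev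
    obtain ⟨N, hN⟩ := eventually_atTop_prod_self'.1 (by rwa [prod_atTop_atTop_eq] at hev)
    refine ⟨N, fun m hm n hn => ?_⟩
    rw [dist_eq_norm, ← Integrable.toL1_sub, L1.norm_of_fun_eq_integral_norm]
    calc ∫ x, ‖((fun x => u m x ^ α) - fun x => u n x ^ α) x‖ ∂μ
        ≤ ∫ x, (ε / 4 * (u m x ^ α + u n x ^ α) + C * midpointGap α (u m x) (u n x)) ∂μ := by
          refine integral_mono ((hui m).sub (hui n)).norm
            ((((hui m).add (hui n)).const_mul _).add
              ((integrable_midpointGap h0 (hum m) (hum n) (hu0 m) (hu0 n) (hui m)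
                (hui n)).const_mul C)) fun x => ?_
          simpa using hle _ _ (hu0 m x) (hu0 n x)
      _ = ε / 4 * (1 + 1) + C * ∫ x, midpointGap α (u m x) (u n x) ∂μ := by
          rw [integral_const_mul_add_add (hui m) (hui n)
              (integrable_midpointGap h0 (hum m) (hum n) (hu0 m) (hu0 n) (hui m) (hui n)), hu1, hu1]
      _ < ε := by
          have := hN m hm n hn
          linarith
  obtain ⟨V, hV⟩ := cauchySeq_tendsto_of_complete hcauchy
  have hVi : Integrable (V : X → ℝ) μ := L1.integrable_coeFn V
  -- Replacing the `L^1` limit by its positive part gives a pointwise nonnegative representative;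
  -- truncation at 0 is 1-Lipschitz and fixes the approximants. The limit sought is `w ^ (1 / α)`.
  set w : X → ℝ := fun x => max (V x) 0 with hw
  have hwm : Measurable w := (Lp.stronglyMeasurable V).measurable.max measurable_const
  have hwi : Integrable w μ := hVi.sup (integrable_zero _ _ _)
  have hw0 : ∀ x, 0 ≤ w x := fun x => le_max_right _ _
  have hvw : ∀ x, (w x ^ (1 / α)) ^ α = w x := fun x => by
    rw [← Real.rpow_mul (hw0 x), one_div_mul_cancel h0.ne', Real.rpow_one]
  have hconv : Tendsto (fun n => ∫ x, |u n x ^ α - w x| ∂μ) atTop (𝓝 0) := by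
    have hd := tendsto_iff_dist_tendsto_zero.1 hV
    refine squeeze_zero (fun n => integral_nonneg fun x => abs_nonneg _) (fun n => ?_) hd
    have : dist (hui n).toL1 V = ∫ x, ‖((fun x => u n x ^ α) - V) x‖ ∂μ := by
      rw [← L1.norm_of_fun_eq_integral_norm (hf := (hui n).sub hVi), dist_eq_norm,
        Integrable.toL1_sub _ _ (hui n) hVi, Integrable.toL1_coeFn]
    rw [this]
    refine integral_mono ((hui n).sub hwi).abs ((hui n).sub hVi).norm fun x => ?_
    simp only [Pi.sub_apply, Real.norm_eq_abs, hw]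
    have := abs_max_sub_max_le_abs (u n x ^ α) (V x) 0
    rwa [max_eq_left (Real.rpow_nonneg (hu0 n x) α)] at this
  have hvi : Integrable (fun x => (w x ^ (1 / α)) ^ α) μ := by simpa only [hvw] using hwi
  have hv0 : (0 : X → ℝ) ≤ fun x => w x ^ (1 / α) := fun x => Real.rpow_nonneg (hw0 x) _
  have hvm : Measurable fun x => w x ^ (1 / α) := by fun_prop
  have hw1 : ∫ x, w x ∂μ = 1 := by
    have : Tendsto (fun n => ∫ x, u n x ^ α ∂μ) atTop (𝓝 (∫ x, w x ∂μ)) := by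
      rw [tendsto_iff_dist_tendsto_zero]
      refine squeeze_zero (fun n => dist_nonneg) (fun n => ?_) hconv
      rw [Real.dist_eq, ← integral_sub (hui n) hwi]
      exact abs_integral_le_integral_abs
    simp only [hu1] at this
    exact tendsto_nhds_unique this tendsto_const_nhds
  refine ⟨fun x => w x ^ (1 / α), hvm, hv0, hvi, by simpa only [hvw] using hw1, ?_⟩
  rw [tendsto_eLpNorm_zero_iff h0]
  have hI n := integrable_abs_sub_rpow h0 (hum n) hvm (hu0 n) hv0 (hui n) hvi
  have e n : ∫⁻ x, ‖(u n - fun x => w x ^ (1 / α)) x‖ₑ ^ α ∂μ =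
      ENNReal.ofReal (∫ x, |u n x - w x ^ (1 / α)| ^ α ∂μ) :=
    lintegral_enorm_rpow_eq h0 (f := u n - fun x => w x ^ (1 / α)) (hI n)
  simp only [e]
  rw [← ENNReal.ofReal_zero]
  refine ENNReal.tendsto_ofReal ?_
  rw [Metric.tendsto_atTop]
  intro ε hε
  obtain ⟨C, hC, hle⟩ := exists_abs_sub_rpow_le h0 (show 0 < ε / 4 by positivity)
  have hev : ∀ᶠ n in atTop, C * ∫ x, |u n x ^ α - w x| ∂μ < ε / 2 := by
    have := hconv.const_mul C
    rw [mul_zero] at this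
    exact this.eventually_lt_const (by positivity)
  obtain ⟨N, hN⟩ := eventually_atTop.1 hev
  refine ⟨N, fun n hn => ?_⟩
  rw [Real.dist_eq, sub_zero, abs_of_nonneg
    (integral_nonneg fun x => Real.rpow_nonneg (abs_nonneg _) _)]
  calc ∫ x, |u n x - w x ^ (1 / α)| ^ α ∂μ
      ≤ ∫ x, (ε / 4 * (u n x ^ α + w x) + C * |u n x ^ α - w x|) ∂μ := by
        refine integral_mono (hI n) ((((hui n).add hwi).const_mul _).add
          (((hui n).sub hwi).abs.const_mul C)) fun x => ?_
        have := hle (u n x) (w x ^ (1 / α)) (hu0 n x) (hv0 x)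
        rwa [hvw] at this
    _ = ε / 4 * (1 + 1) + C * ∫ x, |u n x ^ α - w x| ∂μ := by
        have hd : Integrable (fun x => |u n x ^ α - w x|) μ := ((hui n).sub hwi).abs
        rw [integral_const_mul_add_add (hui n) hwi hd, hu1, hw1]
    _ < ε := by
        have := hN n hn
        linarith

theorem integral_mul_rpow {α : ℝ} {c : ℝ} (hc : 0 ≤ c) {f : X → ℝ} (hf0 : 0 ≤ f) :
    ∫ x, (c * f x) ^ α ∂μ = c ^ α * ∫ x, f x ^ α ∂μ := by
  rw [← integral_const_mul]
  exact integral_congr_ae (.of_forall fun x => Real.mul_rpow hc (hf0 x))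

/-- The normalizations of a sequence `p` optimizing a ratio `F / ‖·‖_α` of an affine functional `F`
and the norm of `L^α`, over convex combinations of its members, converge in `L^α`. -/
theorem exists_tendsto_normalized {α : ℝ} (h0 : 0 < α) (h1 : α ≠ 1) {p : ℕ → X → ℝ}
    (hpm : ∀ n, Measurable (p n)) (hp0 : ∀ n, 0 ≤ p n)
    (hpi : ∀ n, Integrable (fun x => p n x ^ α) μ) {t F : ℕ → ℝ} (ht : ∀ n, 0 < t n)
    (hpt : ∀ n, ∫ x, p n x ^ α ∂μ = t n ^ α) (hF : ∀ n, 0 ≤ F n) {c : ℝ} (hc : 0 < c)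
    (hlim : Tendsto (fun n => F n / t n) atTop (𝓝 c))
    (hopt : ∀ n m (a b : ℝ), 0 ≤ a → 0 ≤ b → a + b = 1 → 0 ≤ SignType.sign (α - 1) *
      (c * (∫ x, (a * p n x + b * p m x) ^ α ∂μ) ^ (1 / α) - (a * F n + b * F m))) :
    ∃ v : X → ℝ, Measurable v ∧ 0 ≤ v ∧ Integrable (fun x => v x ^ α) μ ∧ ∫ x, v x ^ α ∂μ = 1 ∧
      Tendsto (fun n => eLpNorm ((fun x => (t n)⁻¹ * p n x) - v) (ENNReal.ofReal α) μ)
        atTop (𝓝 0) := by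
  have hu0 n : (0 : X → ℝ) ≤ fun x => (t n)⁻¹ * p n x := fun x =>
    mul_nonneg (inv_nonneg.2 (ht n).le) (hp0 n x)
  have hum n : Measurable fun x => (t n)⁻¹ * p n x := (hpm n).const_mul _
  have hui n : Integrable (fun x => ((t n)⁻¹ * p n x) ^ α) μ :=
    ((hpi n).const_mul ((t n)⁻¹ ^ α)).congr
      (.of_forall fun x => (Real.mul_rpow (inv_nonneg.2 (ht n).le) (hp0 n x)).symm)
  have hu1 n : ∫ x, ((t n)⁻¹ * p n x) ^ α ∂μ = 1 := by
    rw [integral_mul_rpow (inv_nonneg.2 (ht n).le) (hp0 n), hpt,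
      ← Real.mul_rpow (inv_nonneg.2 (ht n).le) (ht n).le, inv_mul_cancel₀ (ht n).ne',
      Real.one_rpow]
  refine exists_tendsto_of_midpointGap h0 h1 hum hu0 hui hu1 ?_
  have hbound : Tendsto (fun z : ℕ × ℕ =>
      |1 - ((F z.1 / t z.1 + F z.2 / t z.2) / 2 / c) ^ α|) atTop (𝓝 0) := by
    rw [← prod_atTop_atTop_eq]
    have h2 : Tendsto (fun z : ℕ × ℕ => (F z.1 / t z.1 + F z.2 / t z.2) / 2 / c)
        (atTop ×ˢ atTop) (𝓝 ((c + c) / 2 / c)) :=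
      (((hlim.comp tendsto_fst).add (hlim.comp tendsto_snd)).div_const 2).div_const c
    have h3 := ((((Real.continuous_rpow_const h0.le).tendsto _).comp h2).const_sub 1).abs
    rw [add_self_div_two, div_self hc.ne', Real.one_rpow, sub_self, abs_zero] at h3
    exact h3
  refine squeeze_zero (fun z => integral_nonneg fun x => midpointGap_nonneg _ _ _)
    (fun z => ?_) hbound
  obtain ⟨n, m⟩ := z
  simp only
  rw [integral_midpointGap h0 h1 (hum n) (hum m) (hu0 n) (hu0 m) (hui n) (hui m), hu1, hu1,
    add_self_div_two]
  have hn := ht n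
  have hm := ht m
  -- The midpoint of the normalizations is `τ` times a genuine convex combination of `p n` and `p
  -- m`, to which optimality applies.
  set τ : ℝ := ((t n)⁻¹ + (t m)⁻¹) / 2 with hτ
  have hτ0 : 0 < τ := by positivity
  have hcomb x : ((t n)⁻¹ * p n x + (t m)⁻¹ * p m x) / 2 =
      τ * ((t n)⁻¹ / (2 * τ) * p n x + (t m)⁻¹ / (2 * τ) * p m x) := by
    field_simp
  have ha : 0 ≤ (t n)⁻¹ / (2 * τ) := by positivity
  have hb : 0 ≤ (t m)⁻¹ / (2 * τ) := by positivity
  have hab : (t n)⁻¹ / (2 * τ) + (t m)⁻¹ / (2 * τ) = 1 := by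
    rw [← add_div, div_eq_one_iff_eq (by positivity), hτ]; ring
  have key := hopt n m _ _ ha hb hab
  simp only [hcomb]
  rw [integral_mul_rpow hτ0.le fun x => add_nonneg (mul_nonneg ha (hp0 n x))
    (mul_nonneg hb (hp0 m x))]
  set I := ∫ x, ((t n)⁻¹ / (2 * τ) * p n x + (t m)⁻¹ / (2 * τ) * p m x) ^ α ∂μ with hI
  have hI0 : 0 ≤ I := integral_nonneg fun x => Real.rpow_nonneg (add_nonneg
    (mul_nonneg ha (hp0 n x)) (mul_nonneg hb (hp0 m x))) _
  have hM : τ ^ α * I = (τ * I ^ (1 / α)) ^ α := by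
    rw [Real.mul_rpow hτ0.le (Real.rpow_nonneg hI0 _), ← Real.rpow_mul hI0,
      one_div_mul_cancel h0.ne', Real.rpow_one]
  have hs : (F n / t n + F m / t m) / 2 / c =
      τ * ((t n)⁻¹ / (2 * τ) * F n + (t m)⁻¹ / (2 * τ) * F m) / c := by
    field_simp
  have hFn := hF n
  have hFm := hF m
  have hs0 : 0 ≤ (F n / t n + F m / t m) / 2 / c := by positivity
  rw [hM]
  -- Optimality bounds the midpoint norm above by the averaged ratio over `c` for `α < 1`, and below
  -- for `α > 1`: the side that convexity leaves open.
  rcases lt_or_gt_of_ne h1 with h | h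
  · simp only [sign_neg (show α - 1 < 0 by linarith), SignType.coe_neg_one] at key ⊢
    have hle : τ * I ^ (1 / α) ≤ (F n / t n + F m / t m) / 2 / c := by
      rw [hs, le_div_iff₀ hc, mul_assoc]
      exact mul_le_mul_of_nonneg_left (by linarith) hτ0.le
    have := Real.rpow_le_rpow (mul_nonneg hτ0.le (Real.rpow_nonneg hI0 _)) hle h0.le
    rw [abs_sub_comm]
    exact le_trans (by linarith) (le_abs_self _)
  · simp only [sign_pos (show 0 < α - 1 by linarith), SignType.coe_one] at key ⊢
    have hle : (F n / t n + F m / t m) / 2 / c ≤ τ * I ^ (1 / α) := by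
      rw [hs, div_le_iff₀ hc, mul_assoc]
      exact mul_le_mul_of_nonneg_left (by linarith) hτ0.le
    have := Real.rpow_le_rpow hs0 hle h0.le
    exact le_trans (by linarith) (le_abs_self _)

/-- If the normalizations of probability densities `p n` converge in `L^α` to a unit vector `v`
and no subsequence of `p` tends to zero, then a subsequence of `p` converges in `L^α` to a positive
multiple of `v`. -/
theorem exists_subseq_tendsto_smul {α : ℝ} (h0 : 0 < α) {p : ℕ → X → ℝ}
    (hpm : ∀ n, Measurable (p n)) (hp0 : ∀ n, 0 ≤ p n)
    (hp1 : ∀ n, ∫⁻ x, ENNReal.ofReal (p n x) ∂μ = 1)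
    {t : ℕ → ℝ} (ht : ∀ n, 0 < t n)
    (hpt : ∀ n, eLpNorm (p n) (ENNReal.ofReal α) μ = ENNReal.ofReal (t n))
    {v : X → ℝ} (hvm : Measurable v) (hv : eLpNorm v (ENNReal.ofReal α) μ = 1)
    (hlim : Tendsto (fun n => eLpNorm ((fun x => (t n)⁻¹ * p n x) - v) (ENNReal.ofReal α) μ)
        atTop (𝓝 0))
    (hzero : ∀ φ : ℕ → ℕ, StrictMono φ →
      ¬ Tendsto (fun k => eLpNorm (p (φ k)) (ENNReal.ofReal α) μ) atTop (𝓝 0)) :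
    ∃ T : ℝ, 0 < T ∧ ∃ φ : ℕ → ℕ, StrictMono φ ∧
      Tendsto (fun k => eLpNorm (p (φ k) - T • v) (ENNReal.ofReal α) μ) atTop (𝓝 0) := by
  -- Compactness of `[0, ∞]` gives a limit of the norms; the values 0 and ∞ are then excluded.
  obtain ⟨T, -, φ, hφ, hT⟩ := isCompact_univ.tendsto_subseq (x := fun n => ENNReal.ofReal (t n))
    fun n => Set.mem_univ _
  simp only [Function.comp_def] at hT
  have hT0 : T ≠ 0 := by
    rintro rfl
    exact hzero φ hφ (by simpa only [hpt] using hT)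
  have hlimφ := hlim.comp hφ.tendsto_atTop
  have hTtop : T ≠ ∞ := by
    rintro rfl
    -- With `∫ p = 1`, the `L^1` norm of the normalization is `1 / t`, which tends to 0. Both limits
    -- hold in measure, so `v = 0` a.e., against its unit norm.
    have hL1 : Tendsto (fun k => eLpNorm ((fun x => (t (φ k))⁻¹ * p (φ k) x) - 0) 1 μ)
        atTop (𝓝 0) := by
      have e k : eLpNorm ((fun x => (t (φ k))⁻¹ * p (φ k) x) - 0) 1 μ =
          (ENNReal.ofReal (t (φ k)))⁻¹ := by
        rw [sub_zero, eLpNorm_one_eq_lintegral_enorm, ← ENNReal.ofReal_inv_of_pos (ht _)]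
        have hi := inv_nonneg.2 (ht (φ k)).le
        calc ∫⁻ x, ‖(t (φ k))⁻¹ * p (φ k) x‖ₑ ∂μ
            = ∫⁻ x, ENNReal.ofReal (t (φ k))⁻¹ * ENNReal.ofReal (p (φ k) x) ∂μ := by
              refine lintegral_congr fun x => ?_
              rw [Real.enorm_of_nonneg (mul_nonneg hi (hp0 _ x)), ENNReal.ofReal_mul hi]
          _ = _ := by
              rw [lintegral_const_mul _ (hpm _).ennreal_ofReal, hp1, mul_one]
      simp only [e]
      simpa using tendsto_inv_iff.2 hT
    have hm1 := tendstoInMeasure_of_tendsto_eLpNorm one_ne_zero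
      (fun k => ((hpm (φ k)).const_mul _).aestronglyMeasurable) aestronglyMeasurable_zero hL1
    have hm2 := tendstoInMeasure_of_tendsto_eLpNorm (f := fun k x => (t (φ k))⁻¹ * p (φ k) x)
      (show ENNReal.ofReal α ≠ 0 by simpa using h0)
      (fun k => ((hpm (φ k)).const_mul _).aestronglyMeasurable) hvm.aestronglyMeasurable hlimφ
    have hv0 := tendstoInMeasure_ae_unique hm2 hm1
    rw [eLpNorm_congr_ae hv0] at hv
    simp at hv
  refine ⟨T.toReal, ENNReal.toReal_pos hT0 hTtop, φ, hφ, ?_⟩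
  have htT : Tendsto (fun k => t (φ k)) atTop (𝓝 T.toReal) := by
    have := (ENNReal.tendsto_toReal hTtop).comp hT
    refine this.congr fun k => ?_
    simp [ENNReal.toReal_ofReal (ht _).le]
  have hsplit k : p (φ k) - T.toReal • v =
      t (φ k) • ((fun x => (t (φ k))⁻¹ * p (φ k) x) - v) + (t (φ k) - T.toReal) • v := by
    ext x
    have := (ht (φ k)).ne'
    simp only [Pi.sub_apply, Pi.smul_apply, Pi.add_apply, smul_eq_mul]
    field_simp
    ring
  -- `ENNReal.LpAddConst` is the quasi-triangle constant, needed for `α < 1`.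
  have hB : Tendsto (fun k => ENNReal.LpAddConst (ENNReal.ofReal α) *
      (‖t (φ k)‖ₑ * eLpNorm ((fun x => (t (φ k))⁻¹ * p (φ k) x) - v) (ENNReal.ofReal α) μ +
        ‖t (φ k) - T.toReal‖ₑ * 1)) atTop (𝓝 0) := by
    have h2 : Tendsto (fun k => ‖t (φ k)‖ₑ) atTop (𝓝 ‖T.toReal‖ₑ) := htT.enorm
    have h3 : Tendsto (fun k => ‖t (φ k) - T.toReal‖ₑ) atTop (𝓝 0) := by
      simpa using (htT.sub_const T.toReal).enorm
    have h4 := ENNReal.Tendsto.mul h2 (Or.inr ENNReal.zero_ne_top) hlimφ (Or.inr enorm_ne_top)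
    have h5 := ENNReal.Tendsto.const_mul (h4.add (ENNReal.Tendsto.mul_const (b := 1) h3 (Or.inr ENNReal.one_ne_top)))
      (Or.inr (ENNReal.LpAddConst_lt_top (ENNReal.ofReal α)).ne)
    simpa using h5
  refine tendsto_of_tendsto_of_tendsto_of_le_of_le tendsto_const_nhds hB (fun k => zero_le)
    fun k => ?_
  simp only
  rw [hsplit]
  refine (eLpNorm_add_le' ?_ ?_ _).trans ?_
  · exact ((((hpm _).const_mul _).sub hvm).const_smul (t (φ k))).aestronglyMeasurable
  · exact (hvm.const_smul _).aestronglyMeasurable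
  · rw [eLpNorm_const_smul, eLpNorm_const_smul, hv]

/-! ### The linear functional and its semicontinuity -/

/-- The linear functional `g ↦ ∫ g w dμ` on nonnegative functions. -/
noncomputable def weightedIntegral (μ : Measure X) (w : X → ℝ≥0∞) (g : X → ℝ) : ℝ≥0∞ :=
  ∫⁻ x, ENNReal.ofReal (g x) * w x ∂μ

theorem weightedIntegral_congr (w : X → ℝ≥0∞) {f g : X → ℝ} (h : f =ᵐ[μ] g) :
    weightedIntegral μ w f = weightedIntegral μ w g :=
  lintegral_congr_ae (h.mono fun x hx => by simp only [hx])

theorem weightedIntegral_const_mul {w : X → ℝ≥0∞} (hw : Measurable w) {f : X → ℝ}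
    (hf : Measurable f) {c : ℝ} (hc : 0 ≤ c) :
    weightedIntegral μ w (fun x => c * f x) = ENNReal.ofReal c * weightedIntegral μ w f := by
  unfold weightedIntegral
  rw [← lintegral_const_mul _ (by fun_prop)]
  refine lintegral_congr fun x => ?_
  rw [ENNReal.ofReal_mul hc, mul_assoc]

theorem weightedIntegral_add {w : X → ℝ≥0∞} (hw : Measurable w) {f g : X → ℝ}
    (hf : Measurable f) (hf0 : 0 ≤ f) (hg0 : 0 ≤ g) :
    weightedIntegral μ w (fun x => f x + g x) =
      weightedIntegral μ w f + weightedIntegral μ w g := by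
  unfold weightedIntegral
  rw [← lintegral_add_left (by fun_prop)]
  refine lintegral_congr fun x => ?_
  rw [ENNReal.ofReal_add (hf0 x) (hg0 x), add_mul]

/-- Fatou's lemma along a sequence converging in `L^α`. -/
theorem weightedIntegral_le_of_tendsto_eLpNorm {α : ℝ} (h0 : 0 < α) {w : X → ℝ≥0∞}
    (hw : Measurable w) {u : ℕ → X → ℝ} {v : X → ℝ} (hum : ∀ n, Measurable (u n))
    (hvm : Measurable v)
    (hlim : Tendsto (fun n => eLpNorm (u n - v) (ENNReal.ofReal α) μ) atTop (𝓝 0)) {c : ℝ≥0∞}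
    (hc : Tendsto (fun n => weightedIntegral μ w (u n)) atTop (𝓝 c)) :
    weightedIntegral μ w v ≤ c := by
  obtain ⟨φ, hφ, hae⟩ := (tendstoInMeasure_of_tendsto_eLpNorm
    (show ENNReal.ofReal α ≠ 0 by simpa using h0) (fun n => (hum n).aestronglyMeasurable)
    hvm.aestronglyMeasurable hlim).exists_seq_tendsto_ae
  calc weightedIntegral μ w v
      ≤ ∫⁻ x, liminf (fun k => ENNReal.ofReal (u (φ k) x) * w x) atTop ∂μ := by
        refine lintegral_mono_ae (hae.mono fun x hx => ?_)
        -- Where `v x = 0` the bound is trivial; elsewhere multiplication by `w x` is continuous at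
        -- the limit even if `w x = ∞`.
        rcases eq_or_ne (ENNReal.ofReal (v x)) 0 with h | h
        · simp [h]
        · exact (ENNReal.Tendsto.mul_const (ENNReal.tendsto_ofReal hx) (Or.inl h)).liminf_eq.ge
    _ ≤ liminf (fun k => weightedIntegral μ w (u (φ k))) atTop :=
        lintegral_liminf_le fun k => (hum _).ennreal_ofReal.mul hw
    _ = c := (hc.comp hφ.tendsto_atTop).liminf_eq

/-- Upper semicontinuity of a functional bounded with respect to the norm of `L^α`. -/
theorem le_weightedIntegral_of_tendsto_eLpNorm {α : ℝ} {w : X → ℝ≥0∞}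
    (hw : Measurable w) {B : ℝ≥0∞} (hB : B ≠ ∞)
    (hwB : ∀ g : X → ℝ, Measurable g →
      weightedIntegral μ w g ≤ B * eLpNorm g (ENNReal.ofReal α) μ)
    {u : ℕ → X → ℝ} {v : X → ℝ} (hum : ∀ n, Measurable (u n)) (hvm : Measurable v)
    (hlim : Tendsto (fun n => eLpNorm (u n - v) (ENNReal.ofReal α) μ) atTop (𝓝 0)) {c : ℝ≥0∞}
    (hc : Tendsto (fun n => weightedIntegral μ w (u n)) atTop (𝓝 c)) :
    c ≤ weightedIntegral μ w v := by
  have hr : Tendsto (fun n => weightedIntegral μ w v + B * eLpNorm (u n - v) (ENNReal.ofReal α) μ)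
      atTop (𝓝 (weightedIntegral μ w v)) := by
    simpa using (ENNReal.Tendsto.const_mul hlim (Or.inr hB)).const_add (weightedIntegral μ w v)
  refine le_of_tendsto_of_tendsto' hc hr fun n => ?_
  refine le_trans ?_ (add_le_add_right (hwB _ ((hum n).sub hvm)) _)
  unfold weightedIntegral
  rw [← lintegral_add_left (by fun_prop)]
  refine lintegral_mono fun x => ?_
  rw [← add_mul]
  refine mul_le_mul_left ?_ _
  calc ENNReal.ofReal (u n x) = ENNReal.ofReal (v x + (u n - v) x) := by simp
    _ ≤ _ := ENNReal.ofReal_add_le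

/-! ### Densities and the two Hölder inequalities -/

theorem measurable_density (μ P : Measure X) : Measurable (density μ P) :=
  (P.measurable_rnDeriv μ).ennreal_toReal

theorem density_nonneg (μ P : Measure X) : 0 ≤ density μ P := fun _ => ENNReal.toReal_nonneg

theorem ofReal_density_ae_eq (μ P : Measure X) [SigmaFinite P] :
    (fun x => ENNReal.ofReal (density μ P x)) =ᵐ[μ] P.rnDeriv μ :=
  (P.rnDeriv_lt_top μ).mono fun _ hx => ENNReal.ofReal_toReal hx.ne

theorem lintegral_ofReal_density [SigmaFinite μ] (P : Measure X) [IsProbabilityMeasure P]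
    (hP : P ≪ μ) : ∫⁻ x, ENNReal.ofReal (density μ P x) ∂μ = 1 := by
  rw [lintegral_congr_ae (ofReal_density_ae_eq μ P), Measure.lintegral_rnDeriv hP, measure_univ]

theorem eLpNorm_density_ne_zero [SigmaFinite μ] {α : ℝ} (h0 : 0 < α) (P : Measure X)
    [IsProbabilityMeasure P] (hP : P ≪ μ) :
    eLpNorm (density μ P) (ENNReal.ofReal α) μ ≠ 0 := by
  intro h
  rw [eLpNorm_eq_zero_iff (measurable_density μ P).aestronglyMeasurable (by simpa using h0)] at h
  have h1 := lintegral_ofReal_density P hP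
  rw [lintegral_congr_ae (h.mono fun x hx => by rw [hx])] at h1
  simp at h1

theorem eLpNorm_density_eq {α : ℝ} (h0 : 0 < α) (P : Measure X) [SigmaFinite P] :
    eLpNorm (density μ P) (ENNReal.ofReal α) μ = (∫⁻ x, P.rnDeriv μ x ^ α ∂μ) ^ (1 / α) := by
  rw [eLpNorm_eq_lintegral_rpow h0]
  congr 1
  refine lintegral_congr_ae ((ofReal_density_ae_eq μ P).mono fun x hx => ?_)
  simp only [Real.enorm_of_nonneg (density_nonneg μ P x), hx]

theorem lintegral_rnDeriv_rpow_ne_zero [SigmaFinite μ] {α : ℝ} (h0 : 0 < α) (P : Measure X)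
    [IsProbabilityMeasure P] (hP : P ≪ μ) : ∫⁻ x, P.rnDeriv μ x ^ α ∂μ ≠ 0 := by
  intro h
  apply eLpNorm_density_ne_zero h0 P hP
  rw [eLpNorm_density_eq h0, h, ENNReal.zero_rpow_of_pos (by positivity)]

theorem lintegral_rnDeriv_rpow_ne_top {α : ℝ} (h0 : 0 < α) (P : Measure X)
    [SigmaFinite P] (hP : MemLp (density μ P) (ENNReal.ofReal α) μ) :
    ∫⁻ x, P.rnDeriv μ x ^ α ∂μ ≠ ∞ := by
  intro h
  apply hP.2.ne
  rw [eLpNorm_density_eq h0, h, ENNReal.top_rpow_of_pos (by positivity)]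

/-- Hölder's inequality for `1 < α`. -/
theorem weightedIntegral_rpow_le {α : ℝ} (hα : 1 < α) {q : X → ℝ≥0∞} (hq : Measurable q)
    {g : X → ℝ} (hg : Measurable g) :
    weightedIntegral μ (fun x => q x ^ (α - 1)) g ≤
      (∫⁻ x, q x ^ α ∂μ) ^ (1 - 1 / α) * eLpNorm g (ENNReal.ofReal α) μ := by
  have h0 : 0 < α := by linarith
  have hα' : 1 / α ≤ 1 := by rw [div_le_one h0]; exact hα.le
  rw [eLpNorm_eq_lintegral_rpow h0, mul_comm]
  refine le_trans ?_ (ENNReal.lintegral_mul_norm_pow_le (μ := μ) (f := fun x => ‖g x‖ₑ ^ α)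
    (g := fun x => q x ^ α) (by fun_prop) (by fun_prop) (p := 1 / α) (q := 1 - 1 / α)
    (by positivity) (by linarith) (by ring))
  refine lintegral_mono fun x => ?_
  rw [← ENNReal.rpow_mul, ← ENNReal.rpow_mul, mul_one_div_cancel h0.ne', ENNReal.rpow_one,
    mul_sub, mul_one_div_cancel h0.ne', mul_one]
  exact mul_le_mul_left (Real.ofReal_le_enorm _) _

/-- The reverse Hölder inequality for `α < 1`. -/
theorem eLpNorm_le_weightedIntegral_rpow {α : ℝ} (h0 : 0 < α) (hα : α < 1) {q : X → ℝ≥0∞}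
    (hq : Measurable q) (hqtop : ∀ᵐ x ∂μ, q x < ∞) (hq0 : ∫⁻ x, q x ^ α ∂μ ≠ 0)
    (hqi : ∫⁻ x, q x ^ α ∂μ ≠ ∞) {g : X → ℝ} (hg : Measurable g) (hg0 : 0 ≤ g) :
    eLpNorm g (ENNReal.ofReal α) μ ≤
      weightedIntegral μ (fun x => q x ^ (α - 1)) g * (∫⁻ x, q x ^ α ∂μ) ^ ((1 - α) / α) := by
  rcases eq_or_ne (weightedIntegral μ (fun x => q x ^ (α - 1)) g) ∞ with hF | hF
  · rw [hF, ENNReal.top_mul]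
    · exact le_top
    · simp [ENNReal.rpow_eq_zero_iff, hq0, hqi]
  · have hfin := ae_lt_top (f := fun x => ENNReal.ofReal (g x) * q x ^ (α - 1)) (by fun_prop) hF
    have key : ∫⁻ x, ‖g x‖ₑ ^ α ∂μ ≤ weightedIntegral μ (fun x => q x ^ (α - 1)) g ^ α *
        (∫⁻ x, q x ^ α ∂μ) ^ (1 - α) := by
      refine le_trans (lintegral_mono_ae ?_) (ENNReal.lintegral_mul_norm_pow_le (μ := μ)
        (f := fun x => ENNReal.ofReal (g x) * q x ^ (α - 1))
        (g := fun x => q x ^ α) (by fun_prop) (by fun_prop) (p := α) (q := 1 - α)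
        h0.le (by linarith) (by ring))
      filter_upwards [hfin, hqtop] with x hx hx'
      rw [Real.enorm_of_nonneg (hg0 x)]
      -- Where `q = 0` the weight `q ^ (α - 1)` is `∞`, so finiteness of the integrand forces `g =
      -- 0`.
      rcases eq_or_ne (q x) 0 with hz | hz
      · have : ENNReal.ofReal (g x) = 0 := by
          by_contra h
          rw [hz, ENNReal.zero_rpow_of_neg (by linarith), ENNReal.mul_top h] at hx
          exact lt_irrefl _ hx
        simp [this, h0]
      · rw [ENNReal.mul_rpow_of_nonneg _ _ h0.le, ← ENNReal.rpow_mul, ← ENNReal.rpow_mul, mul_assoc,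
          ← ENNReal.rpow_add _ _ hz hx'.ne,
          show (α - 1) * α + α * (1 - α) = 0 by ring, ENNReal.rpow_zero, mul_one]
    rw [eLpNorm_eq_lintegral_rpow h0]
    refine (ENNReal.rpow_le_rpow key (by positivity)).trans (le_of_eq ?_)
    rw [ENNReal.mul_rpow_of_nonneg _ _ (by positivity), ← ENNReal.rpow_mul, ← ENNReal.rpow_mul,
      mul_one_div_cancel h0.ne', ENNReal.rpow_one, mul_one_div]

/-! ### The entropy as a normalized linear functional -/

theorem one_add_rho (α : ℝ) : 1 + rho α = 1 / α := by unfold rho; ring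

theorem rho_pos {α : ℝ} (h0 : 0 < α) (hα : α < 1) : 0 < rho α := by
  unfold rho
  have := (lt_div_iff₀ h0).2 (by linarith : 1 * α < 1)
  linarith

theorem rho_neg {α : ℝ} (hα : 1 < α) : rho α < 0 := by
  unfold rho
  have := (div_lt_one (by linarith)).2 hα
  linarith

/-- The exponent `1 + ρ = 1/α` undoes the tilting of `p` and leaves `q^α · q⁻¹`. At `q = 0` the
convention matches `0 ^ (α - 1)`, which is `∞` for `α < 1` and 0 for `α > 1`. -/
theorem powPerspective_tilted {α : ℝ} (h0 : 0 < α) (h1 : α ≠ 1) {p q M N : ℝ≥0∞}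
    (hq : q ≠ ∞) (hM0 : M ≠ 0) (hM : M ≠ ∞) (hN0 : N ≠ 0) (hN : N ≠ ∞) :
    powPerspective (rho α) (p ^ α / M) (q ^ α / N) =
      N ^ ((1 - α) / α) * (M ^ (1 / α))⁻¹ * (p * q ^ (α - 1)) := by
  have hMi : M ^ (1 / α) ≠ ∞ := by simp [ENNReal.rpow_eq_top_iff, hM, hM0]
  have hNi : N ^ ((1 - α) / α) ≠ 0 := by simp [ENNReal.rpow_eq_zero_iff, hN, hN0]
  rcases eq_or_ne q 0 with rfl | hq0
  · rw [powPerspective, if_pos (by simp [h0])]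
    rcases lt_or_gt_of_ne h1 with h | h
    · rw [if_pos (rho_pos h0 h), ENNReal.zero_rpow_of_neg (by linarith)]
      rcases eq_or_ne p 0 with rfl | hp
      · simp [h0]
      · rw [ENNReal.mul_top hp, ENNReal.mul_top, ENNReal.mul_top]
        · simp [hNi, hM0, hM]
        · simp [ENNReal.div_eq_zero_iff, ENNReal.rpow_eq_zero_iff, hp, hM, h0.le]
    · rw [if_neg (rho_neg h).not_gt, ENNReal.zero_rpow_of_pos (by linarith)]
      simp
  · set B := q ^ α / N with hB
    have hqα0 : q ^ α ≠ 0 := by simp [ENNReal.rpow_eq_zero_iff, hq0, hq]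
    have hqα : q ^ α ≠ ∞ := by simp [ENNReal.rpow_eq_top_iff, hq0, hq]
    have hB0 : B ≠ 0 := by simp [hB, ENNReal.div_eq_zero_iff, hqα0, hN]
    have hBt : B ≠ ∞ := ENNReal.div_ne_top hqα hN0
    have hBe : B * (B ^ (1 / α))⁻¹ = q ^ (α - 1) * N ^ ((1 - α) / α) := by
      nth_rewrite 1 [← ENNReal.rpow_one B]
      rw [← ENNReal.rpow_neg, ← ENNReal.rpow_add _ _ hB0 hBt, hB, div_eq_mul_inv,
        ENNReal.mul_rpow_of_ne_top hqα (ENNReal.inv_ne_top.2 hN0), ← ENNReal.rpow_mul,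
        ← ENNReal.rpow_neg_one, ← ENNReal.rpow_mul]
      congr 2 <;> field_simp <;> ring
    rw [powPerspective, if_neg hB0, one_add_rho, div_eq_mul_inv (p ^ α / M), div_eq_mul_inv (p ^ α),
      ENNReal.mul_rpow_of_nonneg _ _ (by positivity), ENNReal.mul_rpow_of_nonneg _ _ (by positivity),
      ← ENNReal.rpow_mul, mul_one_div_cancel h0.ne', ENNReal.rpow_one, ENNReal.inv_rpow,
      ENNReal.inv_rpow]
    calc B * (p * (M ^ (1 / α))⁻¹ * (B ^ (1 / α))⁻¹)
        = p * (M ^ (1 / α))⁻¹ * (B * (B ^ (1 / α))⁻¹) := by ring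
      _ = _ := by rw [hBe]; ring

/-- The quotient `∫ p q ^ (α - 1) dμ / ‖p‖_α`, which determines `I_α(P, Q)` for a fixed `Q`. -/
noncomputable def normalizedPairing (α : ℝ) (μ P Q : Measure X) : ℝ≥0∞ :=
  weightedIntegral μ (fun x => Q.rnDeriv μ x ^ (α - 1)) (density μ P) /
    eLpNorm (density μ P) (ENNReal.ofReal α) μ

theorem tilted_rnDeriv_ae_eq [SigmaFinite μ] (α : ℝ) (P : Measure X) :
    (tilted α μ P).rnDeriv μ =ᵐ[μ]
      fun x => P.rnDeriv μ x ^ α / ∫⁻ y, P.rnDeriv μ y ^ α ∂μ :=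
  Measure.rnDeriv_withDensity μ (((P.measurable_rnDeriv μ).pow_const α).div_const _)

theorem lintegral_powPerspective_tilted [SigmaFinite μ] {α : ℝ} (h0 : 0 < α) (h1 : α ≠ 1)
    (P Q : Measure X) [IsProbabilityMeasure P] [IsProbabilityMeasure Q] (hPμ : P ≪ μ)
    (hQμ : Q ≪ μ) (hP : MemLp (density μ P) (ENNReal.ofReal α) μ)
    (hQ : MemLp (density μ Q) (ENNReal.ofReal α) μ) :
    ∫⁻ x, powPerspective (rho α) ((tilted α μ P).rnDeriv μ x) ((tilted α μ Q).rnDeriv μ x) ∂μ =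
      (∫⁻ x, Q.rnDeriv μ x ^ α ∂μ) ^ ((1 - α) / α) * normalizedPairing α μ P Q := by
  have hqm := Q.measurable_rnDeriv μ
  have e : ∀ᵐ x ∂μ,
      powPerspective (rho α) ((tilted α μ P).rnDeriv μ x) ((tilted α μ Q).rnDeriv μ x) =
      (∫⁻ x, Q.rnDeriv μ x ^ α ∂μ) ^ ((1 - α) / α) *
        (eLpNorm (density μ P) (ENNReal.ofReal α) μ)⁻¹ *
        (ENNReal.ofReal (density μ P x) * Q.rnDeriv μ x ^ (α - 1)) := by
    filter_upwards [tilted_rnDeriv_ae_eq α P, tilted_rnDeriv_ae_eq α Q, ofReal_density_ae_eq μ P,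
      Q.rnDeriv_lt_top μ] with x h2 h3 h4 h5
    rw [h2, h3, h4, powPerspective_tilted h0 h1 h5.ne (lintegral_rnDeriv_rpow_ne_zero h0 P hPμ)
      (lintegral_rnDeriv_rpow_ne_top h0 P hP) (lintegral_rnDeriv_rpow_ne_zero h0 Q hQμ)
      (lintegral_rnDeriv_rpow_ne_top h0 Q hQ), eLpNorm_density_eq h0]
  have hm : Measurable fun x => ENNReal.ofReal (density μ P x) * Q.rnDeriv μ x ^ (α - 1) :=
    (measurable_density μ P).ennreal_ofReal.mul (hqm.pow_const _)
  rw [lintegral_congr_ae e, lintegral_const_mul _ hm, normalizedPairing, weightedIntegral,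
    ENNReal.div_eq_inv_mul]
  ring

/-- The two signs cancel. The factor in front of the pairing does not involve `P`, so optimizing the
entropy in `P` means optimizing the pairing, in the direction set by the sign of `ρ`. -/
theorem alphaRelEntropy_eq [SigmaFinite μ] {α : ℝ} (h0 : 0 < α) (h1 : α ≠ 1)
    (P Q : Measure X) [IsProbabilityMeasure P] [IsProbabilityMeasure Q] (hPμ : P ≪ μ)
    (hQμ : Q ≪ μ) (hP : MemLp (density μ P) (ENNReal.ofReal α) μ)
    (hQ : MemLp (density μ Q) (ENNReal.ofReal α) μ) :
    alphaRelEntropy α μ P Q = ((1 / rho α : ℝ) : EReal) * ENNReal.log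
      ((∫⁻ x, Q.rnDeriv μ x ^ α ∂μ) ^ ((1 - α) / α) * normalizedPairing α μ P Q) := by
  rw [alphaRelEntropy, fDivergence, lintegral_powPerspective_tilted h0 h1 P Q hPμ hQμ hP hQ,
    ← mul_assoc, ← EReal.coe_mul]
  have : Real.sign (rho α) * Real.sign (rho α) = 1 := by
    rcases lt_or_gt_of_ne h1 with h | h
    · rw [Real.sign_of_pos (rho_pos h0 h), one_mul]
    · rw [Real.sign_of_neg (rho_neg h)]; norm_num
  rw [this, EReal.coe_one, one_mul, EReal.toENNReal_coe]

/-! ### Limits inside `E` from convexity and closedness -/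

theorem exists_density_ae_eq_of_convex {α : ℝ} {E : Set (ProbabilityMeasure X)}
    (hEα : ∀ P ∈ E, MemLp (density μ (P : Measure X)) (ENNReal.ofReal α) μ)
    (hconv : Convex ℝ (densitySet α μ E)) {P Q : ProbabilityMeasure X} (hP : P ∈ E) (hQ : Q ∈ E)
    {a b : ℝ} (ha : 0 ≤ a) (hb : 0 ≤ b) (hab : a + b = 1) :
    ∃ S ∈ E, density μ (S : Measure X) =ᵐ[μ]
      fun x => a * density μ (P : Measure X) x + b * density μ (Q : Measure X) x := by
  obtain ⟨S, hS, h⟩ := hconv (x := (hEα P hP).toLp) ⟨P, hP, MemLp.coeFn_toLp _⟩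
    (y := (hEα Q hQ).toLp) ⟨Q, hQ, MemLp.coeFn_toLp _⟩ ha hb hab
  refine ⟨S, hS, h.symm.trans ?_⟩
  rw [← MemLp.toLp_const_smul, ← MemLp.toLp_const_smul, ← MemLp.toLp_add]
  exact MemLp.coeFn_toLp _

/-- `lpDist` and `eLpNorm` are positive powers of the same integral, so they tend to zero together.
-/
theorem exists_density_ae_eq_of_isLpClosed {α : ℝ} (h0 : 0 < α) {E : Set (ProbabilityMeasure X)}
    (hEα : ∀ P ∈ E, MemLp (density μ (P : Measure X)) (ENNReal.ofReal α) μ)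
    (hclosed : IsLpClosed α (densitySet α μ E)) {P : ℕ → ProbabilityMeasure X}
    (hP : ∀ n, P n ∈ E) {f : X → ℝ} (hf : MemLp f (ENNReal.ofReal α) μ)
    (hlim : Tendsto (fun n => eLpNorm (density μ (P n : Measure X) - f) (ENNReal.ofReal α) μ)
      atTop (𝓝 0)) :
    ∃ Q ∈ E, density μ (Q : Measure X) =ᵐ[μ] f := by
  suffices h : hf.toLp ∈ densitySet α μ E by
    obtain ⟨Q, hQ, hae⟩ := h
    exact ⟨Q, hQ, hae.symm.trans hf.coeFn_toLp⟩
  refine hclosed _ fun ε hε => ?_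
  have h1 := (tendsto_eLpNorm_zero_iff h0 _).1 hlim
  have hpos : 0 < min 1 (1 / α) := lt_min one_pos (by positivity)
  have h2 := (ENNReal.continuous_rpow_const (y := min 1 (1 / α))).tendsto 0 |>.comp h1
  rw [ENNReal.zero_rpow_of_pos hpos] at h2
  obtain ⟨n, hn⟩ := (h2.eventually_lt_const hε).exists
  refine ⟨(hEα _ (hP n)).toLp, ⟨P n, hP n, MemLp.coeFn_toLp _⟩, ?_⟩
  refine lt_of_eq_of_lt ?_ hn
  simp only [lpDist, Function.comp_apply]
  congr 1
  refine lintegral_congr_ae ?_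
  filter_upwards [hf.coeFn_toLp, (hEα _ (hP n)).coeFn_toLp] with x hx hx'
  rw [hx, hx', Pi.sub_apply, ← neg_sub, enorm_neg]

/-- Otherwise closedness would make 0 the density of a probability measure. -/
theorem not_tendsto_eLpNorm_density_zero [SigmaFinite μ] {α : ℝ} (h0 : 0 < α)
    {E : Set (ProbabilityMeasure X)} (hEμ : ∀ P ∈ E, (P : Measure X) ≪ μ)
    (hEα : ∀ P ∈ E, MemLp (density μ (P : Measure X)) (ENNReal.ofReal α) μ)
    (hclosed : IsLpClosed α (densitySet α μ E)) {P : ℕ → ProbabilityMeasure X}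
    (hP : ∀ n, P n ∈ E) :
    ¬ Tendsto (fun n => eLpNorm (density μ (P n : Measure X)) (ENNReal.ofReal α) μ)
      atTop (𝓝 0) := by
  intro h
  obtain ⟨Q, hQ, hQ0⟩ := exists_density_ae_eq_of_isLpClosed h0 hEα hclosed hP (f := 0)
    MemLp.zero (by simpa only [sub_zero] using h)
  exact eLpNorm_density_ne_zero h0 (Q : Measure X) (hEμ Q hQ) (by rw [eLpNorm_congr_ae hQ0]; simp)

theorem eLpNorm_density_eq_ofReal {α : ℝ} (h0 : 0 < α) (P : Measure X)
    (hP : MemLp (density μ P) (ENNReal.ofReal α) μ) :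
    (∫ x, density μ P x ^ α ∂μ) ^ (1 / α) =
      (eLpNorm (density μ P) (ENNReal.ofReal α) μ).toReal := by
  rw [eLpNorm_eq_ofReal_integral h0 (density_nonneg μ P)
    (integrable_rpow_of_memLp h0 (density_nonneg μ P) hP), ← ENNReal.toReal_rpow,
    ENNReal.toReal_ofReal (integral_nonneg fun x => Real.rpow_nonneg (density_nonneg μ P x) _)]

/-- A sequence in `E` along which the ratio `∫ p w dμ / ‖p‖_α` tends to its optimum `c` yields a
member `Q` of `E` whose normalized density is the limit of the normalized densities of a sequence
with the same limit of the ratio. -/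
theorem exists_mem_normalized_limit [SigmaFinite μ] {α : ℝ} (h0 : 0 < α) (h1 : α ≠ 1)
    {E : Set (ProbabilityMeasure X)} (hEμ : ∀ P ∈ E, (P : Measure X) ≪ μ)
    (hEα : ∀ P ∈ E, MemLp (density μ (P : Measure X)) (ENNReal.ofReal α) μ)
    (hconv : Convex ℝ (densitySet α μ E)) (hclosed : IsLpClosed α (densitySet α μ E))
    {w : X → ℝ≥0∞} (hw : Measurable w) {P : ℕ → ProbabilityMeasure X} (hP : ∀ n, P n ∈ E)
    (hPw : ∀ n, weightedIntegral μ w (density μ (P n : Measure X)) ≠ ∞) {c : ℝ} (hc : 0 < c)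
    (hlim : Tendsto (fun n => weightedIntegral μ w (density μ (P n : Measure X)) /
      eLpNorm (density μ (P n : Measure X)) (ENNReal.ofReal α) μ) atTop (𝓝 (ENNReal.ofReal c)))
    (hopt : ∀ S ∈ E, weightedIntegral μ w (density μ (S : Measure X)) ≠ ∞ →
      0 ≤ SignType.sign (α - 1) *
        (c * (eLpNorm (density μ (S : Measure X)) (ENNReal.ofReal α) μ).toReal -
          (weightedIntegral μ w (density μ (S : Measure X))).toReal)) :
    ∃ Q ∈ E, ∃ (u : ℕ → X → ℝ) (v : X → ℝ), (∀ n, Measurable (u n)) ∧ Measurable v ∧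
      Tendsto (fun n => eLpNorm (u n - v) (ENNReal.ofReal α) μ) atTop (𝓝 0) ∧
      Tendsto (fun n => weightedIntegral μ w (u n)) atTop (𝓝 (ENNReal.ofReal c)) ∧
      weightedIntegral μ w (density μ (Q : Measure X)) /
        eLpNorm (density μ (Q : Measure X)) (ENNReal.ofReal α) μ = weightedIntegral μ w v := by
  set p : ℕ → X → ℝ := fun n => density μ (P n : Measure X) with hp
  have hpm n : Measurable (p n) := measurable_density _ _
  have hp0 n : 0 ≤ p n := density_nonneg _ _
  have hpL n : MemLp (p n) (ENNReal.ofReal α) μ := hEα _ (hP n)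
  have hpi n := integrable_rpow_of_memLp h0 (hp0 n) (hpL n)
  set t : ℕ → ℝ := fun n => (eLpNorm (p n) (ENNReal.ofReal α) μ).toReal with ht_def
  set F : ℕ → ℝ := fun n => (weightedIntegral μ w (p n)).toReal with hF_def
  have ht n : 0 < t n := ENNReal.toReal_pos
    (eLpNorm_density_ne_zero h0 _ (hEμ _ (hP n))) (hpL n).2.ne
  have htn n : eLpNorm (p n) (ENNReal.ofReal α) μ = ENNReal.ofReal (t n) :=
    (ENNReal.ofReal_toReal (hpL n).2.ne).symm
  have hFn n : weightedIntegral μ w (p n) = ENNReal.ofReal (F n) :=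
    (ENNReal.ofReal_toReal (hPw n)).symm
  have hpt n : ∫ x, p n x ^ α ∂μ = t n ^ α := by
    simp only [ht_def, hp]
    rw [← eLpNorm_density_eq_ofReal h0 _ (hpL n), ← Real.rpow_mul, one_div_mul_cancel h0.ne',
      Real.rpow_one]
    exact integral_nonneg fun x => Real.rpow_nonneg (hp0 n x) _
  have hlim' : Tendsto (fun n => F n / t n) atTop (𝓝 c) := by
    have := (ENNReal.tendsto_toReal ENNReal.ofReal_ne_top).comp hlim
    rw [ENNReal.toReal_ofReal hc.le] at this
    exact this.congr fun n => ENNReal.toReal_div _ _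
  have hopt' : ∀ n m (a b : ℝ), 0 ≤ a → 0 ≤ b → a + b = 1 → 0 ≤ SignType.sign (α - 1) *
      (c * (∫ x, (a * p n x + b * p m x) ^ α ∂μ) ^ (1 / α) - (a * F n + b * F m)) := by
    intro n m a b ha hb hab
    obtain ⟨S, hS, hSe⟩ := exists_density_ae_eq_of_convex hEα hconv (hP n) (hP m) ha hb hab
    have hW : weightedIntegral μ w (density μ (S : Measure X)) =
        ENNReal.ofReal (a * F n + b * F m) := by
      rw [weightedIntegral_congr w hSe, weightedIntegral_add hw ((hpm n).const_mul a)
        (fun x => mul_nonneg ha (hp0 n x)) (fun x => mul_nonneg hb (hp0 m x)),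
        weightedIntegral_const_mul hw (hpm n) ha, weightedIntegral_const_mul hw (hpm m) hb]
      simp only [hFn]
      rw [← ENNReal.ofReal_mul ha, ← ENNReal.ofReal_mul hb, ← ENNReal.ofReal_add
        (mul_nonneg ha ENNReal.toReal_nonneg) (mul_nonneg hb ENNReal.toReal_nonneg)]
    have h := hopt S hS (by rw [hW]; exact ENNReal.ofReal_ne_top)
    rw [hW, ENNReal.toReal_ofReal (add_nonneg (mul_nonneg ha ENNReal.toReal_nonneg)
      (mul_nonneg hb ENNReal.toReal_nonneg)), ← eLpNorm_density_eq_ofReal h0 _ (hEα S hS),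
      integral_congr_ae (hSe.mono fun x hx => by
        show density μ (S : Measure X) x ^ α = (a * p n x + b * p m x) ^ α
        rw [hx])] at h
    exact h
  obtain ⟨v, hvm, hv0, hvi, hv1, hvlim⟩ := exists_tendsto_normalized h0 h1 hpm hp0 hpi ht hpt
    (fun n => ENNReal.toReal_nonneg) hc hlim' hopt'
  have hvn : eLpNorm v (ENNReal.ofReal α) μ = 1 := by
    rw [eLpNorm_eq_ofReal_integral h0 hv0 hvi, hv1]; simp
  obtain ⟨T, hT, φ, hφ, hTlim⟩ := exists_subseq_tendsto_smul h0 hpm hp0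
    (fun n => lintegral_ofReal_density _ (hEμ _ (hP n))) ht htn hvm hvn hvlim
    (fun φ _ => not_tendsto_eLpNorm_density_zero h0 hEμ hEα hclosed fun k => hP (φ k))
  obtain ⟨Q, hQ, hQe⟩ := exists_density_ae_eq_of_isLpClosed h0 hEα hclosed (fun k => hP (φ k))
    ((memLp_of_integrable_rpow h0 hv0 hvm hvi).const_smul T) hTlim
  refine ⟨Q, hQ, fun n x => (t n)⁻¹ * p n x, v, fun n => (hpm n).const_mul _, hvm, hvlim, ?_, ?_⟩
  · refine (ENNReal.tendsto_ofReal hlim').congr fun n => ?_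
    rw [weightedIntegral_const_mul hw (hpm n) (inv_nonneg.2 (ht n).le), hFn,
      ← ENNReal.ofReal_mul (inv_nonneg.2 (ht n).le), inv_mul_eq_div]
  -- The density of `Q` is `T • v` with `v` of norm 1, so the factor `T` cancels in the ratio.
  · rw [weightedIntegral_congr w hQe, eLpNorm_congr_ae hQe, eLpNorm_const_smul, hvn, mul_one,
      show T • v = fun x => T * v x from rfl, weightedIntegral_const_mul hw hvm hT.le,
      Real.enorm_of_nonneg hT.le, mul_comm, ENNReal.mul_div_cancel_right]
    · simpa using hT
    · exact ENNReal.ofReal_ne_top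

/-! ### Optimizers of the normalized pairing -/

variable [SigmaFinite μ] {α : ℝ} {E : Set (ProbabilityMeasure X)}

/-- For `α < 1` the normalized pairing has a minimizer. -/
theorem exists_forall_normalizedPairing_le (h0 : 0 < α) (h1 : α < 1)
    (hEμ : ∀ P ∈ E, (P : Measure X) ≪ μ)
    (hEα : ∀ P ∈ E, MemLp (density μ (P : Measure X)) (ENNReal.ofReal α) μ)
    (hconv : Convex ℝ (densitySet α μ E)) (hclosed : IsLpClosed α (densitySet α μ E))
    (R : ProbabilityMeasure X) (hRμ : (R : Measure X) ≪ μ)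
    (hRα : MemLp (density μ (R : Measure X)) (ENNReal.ofReal α) μ)
    (hfin : ∃ P ∈ E, normalizedPairing α μ (P : Measure X) (R : Measure X) ≠ ∞) :
    ∃ Q ∈ E, ∀ P ∈ E, normalizedPairing α μ (Q : Measure X) (R : Measure X) ≤
      normalizedPairing α μ (P : Measure X) (R : Measure X) := by
  obtain ⟨P₀, hP₀, hfin⟩ := hfin
  set Φ : ProbabilityMeasure X → ℝ≥0∞ :=
    fun P => normalizedPairing α μ (P : Measure X) (R : Measure X) with hΦ
  have hNR0 := lintegral_rnDeriv_rpow_ne_zero h0 (R : Measure X) hRμ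
  have hNR := lintegral_rnDeriv_rpow_ne_top h0 (R : Measure X) hRα
  have hRm := (R : Measure X).measurable_rnDeriv μ
  have hn0 : ∀ P ∈ E, eLpNorm (density μ (P : Measure X)) (ENNReal.ofReal α) μ ≠ 0 :=
    fun P hP => eLpNorm_density_ne_zero h0 _ (hEμ P hP)
  have hnt : ∀ P ∈ E, eLpNorm (density μ (P : Measure X)) (ENNReal.ofReal α) μ ≠ ∞ :=
    fun P hP => (hEα P hP).2.ne
  set c := sInf (Φ '' E) with hc_def
  have hct : c ≠ ∞ := ((sInf_le (Set.mem_image_of_mem Φ hP₀)).trans_lt hfin.lt_top).ne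
  have hκt : (∫⁻ x, (R : Measure X).rnDeriv μ x ^ α ∂μ) ^ ((1 - α) / α) ≠ ∞ := by
    simp [ENNReal.rpow_eq_top_iff, hNR0, hNR]
  have hκ0 : (∫⁻ x, (R : Measure X).rnDeriv μ x ^ α ∂μ) ^ ((1 - α) / α) ≠ 0 := by
    simp [ENNReal.rpow_eq_zero_iff, hNR0, hNR]
  have hc0 : c ≠ 0 := by
    have : ((∫⁻ x, (R : Measure X).rnDeriv μ x ^ α ∂μ) ^ ((1 - α) / α))⁻¹ ≤ c := by
      refine le_sInf ?_
      rintro _ ⟨P, hP, rfl⟩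
      have h := eLpNorm_le_weightedIntegral_rpow h0 h1 hRm ((R : Measure X).rnDeriv_lt_top μ) hNR0
        hNR (measurable_density μ (P : Measure X)) (density_nonneg _ _)
      rw [hΦ]
      simp only [normalizedPairing]
      rw [ENNReal.le_div_iff_mul_le (Or.inl (hn0 P hP)) (Or.inl (hnt P hP)), mul_comm,
        ← div_eq_mul_inv, ENNReal.div_le_iff hκ0 hκt]
      exact h
    exact ((ENNReal.inv_pos.2 hκt).trans_le this).ne'
  obtain ⟨y, -, hy, hyE⟩ := exists_seq_tendsto_sInf (S := Φ '' E) ⟨_, P₀, hP₀, rfl⟩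
    (OrderBot.bddBelow _)
  -- The infimum is finite, so the ratios are eventually finite; shifting by `N` makes every pairing
  -- in the sequence finite.
  obtain ⟨N, hN⟩ := eventually_atTop.1 (hy.eventually_lt_const hct.lt_top)
  choose P hP hPy using hyE
  have hlim : Tendsto (fun n => Φ (P (n + N))) atTop (𝓝 (ENNReal.ofReal c.toReal)) := by
    rw [ENNReal.ofReal_toReal hct]
    simpa only [hPy, Function.comp_def] using hy.comp (tendsto_add_atTop_nat N)
  obtain ⟨Q, hQ, u, v, hum, hvm, huv, huc, hQv⟩ := exists_mem_normalized_limit h0 h1.ne hEμ hEα hconv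
    hclosed (hRm.pow_const (α - 1)) (P := fun n => P (n + N)) (fun n => hP _) (fun n h => by
      have h2 := hN (n + N) (Nat.le_add_left _ _)
      rw [← hPy, hΦ] at h2
      simp only [normalizedPairing] at h2
      rw [h, ENNReal.top_div_of_ne_top (hnt _ (hP _))] at h2
      exact lt_irrefl _ h2) (ENNReal.toReal_pos hc0 hct) hlim (fun S hS hSt => by
      have h2 : c ≤ Φ S := sInf_le (Set.mem_image_of_mem Φ hS)
      rw [hΦ] at h2
      simp only [normalizedPairing] at h2
      rw [ENNReal.le_div_iff_mul_le (Or.inl (hn0 S hS)) (Or.inl (hnt S hS))] at h2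
      have h3 := ENNReal.toReal_mono hSt h2
      rw [ENNReal.toReal_mul] at h3
      rw [sign_neg (by linarith)]
      simp only [SignType.coe_neg_one]
      linarith)
  refine ⟨Q, hQ, fun S hS => ?_⟩
  have hle := weightedIntegral_le_of_tendsto_eLpNorm h0 (hRm.pow_const (α - 1)) hum hvm huv huc
  rw [← hQv, ENNReal.ofReal_toReal hct] at hle
  exact hle.trans (sInf_le (Set.mem_image_of_mem Φ hS))

/-- For `1 < α` the normalized pairing has a maximizer. -/
theorem exists_forall_le_normalizedPairing (h1 : 1 < α)
    (hEμ : ∀ P ∈ E, (P : Measure X) ≪ μ)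
    (hEα : ∀ P ∈ E, MemLp (density μ (P : Measure X)) (ENNReal.ofReal α) μ)
    (hconv : Convex ℝ (densitySet α μ E)) (hclosed : IsLpClosed α (densitySet α μ E))
    (R : ProbabilityMeasure X) (hRμ : (R : Measure X) ≪ μ)
    (hRα : MemLp (density μ (R : Measure X)) (ENNReal.ofReal α) μ)
    (hpos : ∃ P ∈ E, normalizedPairing α μ (P : Measure X) (R : Measure X) ≠ 0) :
    ∃ Q ∈ E, ∀ P ∈ E, normalizedPairing α μ (P : Measure X) (R : Measure X) ≤
      normalizedPairing α μ (Q : Measure X) (R : Measure X) := by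
  have h0 : 0 < α := by linarith
  obtain ⟨P₀, hP₀, hpos⟩ := hpos
  set Φ : ProbabilityMeasure X → ℝ≥0∞ :=
    fun P => normalizedPairing α μ (P : Measure X) (R : Measure X) with hΦ
  have hNR0 := lintegral_rnDeriv_rpow_ne_zero h0 (R : Measure X) hRμ
  have hNR := lintegral_rnDeriv_rpow_ne_top h0 (R : Measure X) hRα
  have hRm := (R : Measure X).measurable_rnDeriv μ
  have hn0 : ∀ P ∈ E, eLpNorm (density μ (P : Measure X)) (ENNReal.ofReal α) μ ≠ 0 :=
    fun P hP => eLpNorm_density_ne_zero h0 _ (hEμ P hP)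
  have hnt : ∀ P ∈ E, eLpNorm (density μ (P : Measure X)) (ENNReal.ofReal α) μ ≠ ∞ :=
    fun P hP => (hEα P hP).2.ne
  set B := (∫⁻ x, (R : Measure X).rnDeriv μ x ^ α ∂μ) ^ (1 - 1 / α) with hB_def
  have hB : B ≠ ∞ := by simp [hB_def, ENNReal.rpow_eq_top_iff, hNR0, hNR]
  have hbound : ∀ g : X → ℝ, Measurable g →
      weightedIntegral μ (fun x => (R : Measure X).rnDeriv μ x ^ (α - 1)) g ≤
        B * eLpNorm g (ENNReal.ofReal α) μ := fun g hg => weightedIntegral_rpow_le h1 hRm hg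
  have hPw : ∀ P ∈ E, weightedIntegral μ (fun x => (R : Measure X).rnDeriv μ x ^ (α - 1))
      (density μ (P : Measure X)) ≠ ∞ := fun P hP =>
    ((hbound _ (measurable_density _ _)).trans_lt (ENNReal.mul_lt_top hB.lt_top
      (hnt P hP).lt_top)).ne
  set c := sSup (Φ '' E) with hc_def
  have hc0 : c ≠ 0 := ((pos_iff_ne_zero.2 hpos).trans_le (le_sSup (Set.mem_image_of_mem Φ hP₀))).ne'
  have hct : c ≠ ∞ := by
    have : c ≤ B := by
      refine sSup_le ?_
      rintro _ ⟨P, hP, rfl⟩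
      rw [hΦ]
      simp only [normalizedPairing]
      rw [ENNReal.div_le_iff (hn0 P hP) (hnt P hP)]
      exact hbound _ (measurable_density _ _)
    exact (this.trans_lt hB.lt_top).ne
  obtain ⟨y, -, hy, hyE⟩ := exists_seq_tendsto_sSup (S := Φ '' E) ⟨_, P₀, hP₀, rfl⟩
    (OrderTop.bddAbove _)
  choose P hP hPy using hyE
  have hlim : Tendsto (fun n => Φ (P n)) atTop (𝓝 (ENNReal.ofReal c.toReal)) := by
    rw [ENNReal.ofReal_toReal hct]
    simpa only [hPy] using hy
  obtain ⟨Q, hQ, u, v, hum, hvm, huv, huc, hQv⟩ := exists_mem_normalized_limit h0 h1.ne' hEμ hEα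
    hconv hclosed (hRm.pow_const (α - 1)) hP (fun n => hPw _ (hP n)) (ENNReal.toReal_pos hc0 hct)
    hlim (fun S hS hSt => by
      have h2 : Φ S ≤ c := le_sSup (Set.mem_image_of_mem Φ hS)
      rw [hΦ] at h2
      simp only [normalizedPairing] at h2
      rw [ENNReal.div_le_iff (hn0 S hS) (hnt S hS)] at h2
      have h3 := ENNReal.toReal_mono (ENNReal.mul_ne_top hct (hnt S hS)) h2
      rw [ENNReal.toReal_mul] at h3
      rw [sign_pos (by linarith)]
      simp only [SignType.coe_one]
      linarith)
  refine ⟨Q, hQ, fun S hS => ?_⟩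
  have hle := le_weightedIntegral_of_tendsto_eLpNorm (hRm.pow_const (α - 1)) hB hbound hum hvm
    huv huc
  rw [← hQv, ENNReal.ofReal_toReal hct] at hle
  exact le_trans (le_sSup (Set.mem_image_of_mem Φ hS)) hle

end AlphaEntropy

theorem mainTheorem1 {X : Type*} [MeasurableSpace X] (α : ℝ) (hα : 0 < α) (hα1 : α ≠ 1)
    (μ : Measure X) [SigmaFinite μ] (E : Set (ProbabilityMeasure X))
    (hEμ : ∀ P ∈ E, (P : Measure X) ≪ μ)
    (hEα : ∀ P ∈ E, MemLp (AlphaEntropy.density μ (P : Measure X)) (ENNReal.ofReal α) μ)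
    (hconv : Convex ℝ (AlphaEntropy.densitySet α μ E))
    (hclosed : AlphaEntropy.IsLpClosed α (AlphaEntropy.densitySet α μ E))
    (R : ProbabilityMeasure X) (hRμ : (R : Measure X) ≪ μ)
    (hRα : MemLp (AlphaEntropy.density μ (R : Measure X)) (ENNReal.ofReal α) μ)
    (hfin : ∃ P ∈ E, AlphaEntropy.alphaRelEntropy α μ (P : Measure X) (R : Measure X) < ⊤) :
    ∃ Q : ProbabilityMeasure X, AlphaEntropy.IsAlphaProjection α μ E R Q := by
  have hent : ∀ P ∈ E, _ := fun P hP => AlphaEntropy.alphaRelEntropy_eq hα hα1 (P : Measure X)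
    (R : Measure X) (hEμ P hP) hRμ (hEα P hP) hRα
  have hκ0 : (∫⁻ x, (R : Measure X).rnDeriv μ x ^ α ∂μ) ^ ((1 - α) / α) ≠ 0 := by
    simp [ENNReal.rpow_eq_zero_iff,
      AlphaEntropy.lintegral_rnDeriv_rpow_ne_zero hα (R : Measure X) hRμ,
      AlphaEntropy.lintegral_rnDeriv_rpow_ne_top hα (R : Measure X) hRα]
  suffices h : ∃ Q ∈ E, ∀ P ∈ E, AlphaEntropy.alphaRelEntropy α μ (Q : Measure X) (R : Measure X) ≤
      AlphaEntropy.alphaRelEntropy α μ (P : Measure X) (R : Measure X) by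
    obtain ⟨Q, hQ, hle⟩ := h
    exact ⟨Q, hQ, le_antisymm (le_iInf₂ hle) (iInf₂_le Q hQ)⟩
  obtain ⟨P₀, hP₀, hfin⟩ := hfin
  rw [hent P₀ hP₀] at hfin
  -- Finite entropy means a finite pairing when `ρ > 0` and a nonzero pairing when `ρ < 0`; in the
  -- latter case multiplication by `1 / ρ` reverses the order.
  rcases lt_or_gt_of_ne hα1 with h | h
  · have hρ : 0 < 1 / AlphaEntropy.rho α := one_div_pos.2 (AlphaEntropy.rho_pos hα h)
    obtain ⟨Q, hQ, hle⟩ := AlphaEntropy.exists_forall_normalizedPairing_le hα h hEμ hEα hconv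
      hclosed R hRμ hRα ⟨P₀, hP₀, fun ht => by
        rw [ht, ENNReal.mul_top hκ0, ENNReal.log_top, EReal.coe_mul_top_of_pos hρ] at hfin
        exact lt_irrefl _ hfin⟩
    refine ⟨Q, hQ, fun P hP => ?_⟩
    rw [hent P hP, hent Q hQ]
    exact mul_le_mul_of_nonneg_left (ENNReal.log_monotone (by gcongr; exact hle P hP))
      (EReal.coe_nonneg.2 hρ.le)
  · have hρ : 1 / AlphaEntropy.rho α < 0 := one_div_neg.2 (AlphaEntropy.rho_neg h)
    obtain ⟨Q, hQ, hle⟩ := AlphaEntropy.exists_forall_le_normalizedPairing h hEμ hEα hconv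
      hclosed R hRμ hRα ⟨P₀, hP₀, fun ht => by
        rw [ht, mul_zero, ENNReal.log_zero, EReal.coe_mul_bot_of_neg hρ] at hfin
        exact lt_irrefl _ hfin⟩
    refine ⟨Q, hQ, fun P hP => ?_⟩
    rw [hent P hP, hent Q hQ, mul_comm, mul_comm (_ : EReal) (ENNReal.log _)]
    exact EReal.mul_le_mul_of_nonpos_right (ENNReal.log_monotone (by gcongr; exact hle P hP))
      (EReal.coe_nonpos.2 hρ.le)
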